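/- Let $K$ be a finite connected 4-regular simple graph that is internally 6-edge-connected, that is, removing any 5 edges of $K$ leaves at most one connected component that is not an isolated vertex. A graph $G = K - v$ obtained by deleting one vertex $v$ from such a $K$ is called primitive divergent. Let $\Psi_G = \sum_T \prod_{e \notin T} \alpha_e \in \mathbb{Z}[\alpha_e : e \in E(G)]$ be the Kirchhoff polynomial of $G$, where $T$ runs over the spanning trees of $G$. For a prime power $q$ let $[\Psi_G]_q$ be the number of $x \in \mathbb{F}_q^{E(G)}$ with $\Psi_G(x) = 0$, and define the $c_2$ invariant of $G$ at $q$ by $c_2^{(q)}(G) = [\Psi_G]_q / q^2 \bmod q$. Theorem 1. Let $G$ be a primitive divergent graph, $p$ a prime and $q = p^s$ with $s \geq 1$. Then $q^2$ divides $[\Psi_G]_q$ (so that $c_2^{(q)}(G)$ is well defined), and $$c_2^{(q)}(G) \equiv (-1)^{s+1} \bigl(c_2^{(p)}(G)\bigr)^s \pmod p.$$ In particular, the $c_2$ invariant at $p$ determines the $c_2$ invariant modulo $p$ at every power of $p$: if $G$ and $G'$ are primitive divergent graphs with $c_2^{(p)}(G) \equiv c_2^{(p)}(G') \pmod p$, then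 $c_2^{(q)}(G) \equiv c_2^{(q)}(G') \pmod p$. -/

import Mathlib

/-! Kirchhoff polynomials, point counts over finite fields, primitive divergent graphs, and the
`c₂` invariant. -/

universe u v

namespace C2Invariant

/-- The edge sets `T` of the spanning trees of `G`: those sets of edges of `G` for which the graph
on all vertices of `G` with edge set `T` is a tree. -/
def IsSpanningTree {V : Type u} (G : SimpleGraph V) (T : Finset G.edgeSet) : Prop :=
  (SimpleGraph.fromEdgeSet {e : Sym2 V | ∃ h : e ∈ G.edgeSet, (⟨e, h⟩ : G.edgeSet) ∈ T}).IsTree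

open Classical in
/-- The Kirchhoff polynomial `Ψ_G = ∑_T ∏_{e ∉ T} α_e`, with one variable for each edge of `G`;
the sum runs over all spanning trees `T` of `G`. -/
noncomputable def kirchhoffPoly {V : Type u} [Fintype V] (G : SimpleGraph V) :
    MvPolynomial G.edgeSet ℤ :=
  ∑ T : Finset G.edgeSet with IsSpanningTree G T, ∏ e ∈ Tᶜ, MvPolynomial.X e

/-- The number of zeros with coordinates in `F` of a polynomial with integer coefficients. -/
noncomputable def pointCount {σ : Type u} (P : MvPolynomial σ ℤ) (F : Type v) [Field F] : ℕ :=
  Nat.card {x : σ → F // MvPolynomial.aeval x P = 0}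

/-- `[Ψ_G]_q` for `q = p ^ s`: the number of points over the field with `q` elements at which the
Kirchhoff polynomial of `G` vanishes. -/
noncomputable def kirchhoffCount {V : Type u} [Fintype V] (G : SimpleGraph V)
    (p : ℕ) [Fact p.Prime] (s : ℕ) : ℕ :=
  pointCount (kirchhoffPoly G) (GaloisField p s)

/-- The `c₂` invariant of `G` at `q = p ^ s`, the residue class modulo `q` of `[Ψ_G]_q / q ^ 2`.
It is meaningful when `q ^ 2` divides `[Ψ_G]_q`. -/
noncomputable def c2 {V : Type u} [Fintype V] (G : SimpleGraph V)
    (p : ℕ) [Fact p.Prime] (s : ℕ) : ZMod (p ^ s) :=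
  ((kirchhoffCount G p s / (p ^ s) ^ 2 : ℕ) : ZMod (p ^ s))

/-- Removing any five edges of `K` leaves at most one connected component that is not an isolated
vertex. -/
def InternallySixEdgeConnected {W : Type u} (K : SimpleGraph W) : Prop :=
  ∀ S : Finset (Sym2 W), (S : Set (Sym2 W)) ⊆ K.edgeSet → S.card = 5 →
    {C : (K.deleteEdges (S : Set (Sym2 W))).ConnectedComponent | C.supp.Nontrivial}.Subsingleton

open Classical in
/-- `G` is primitive divergent: it arises by deleting one vertex from a connected, 4-regular,
internally 6-edge-connected simple graph `K`. The vertices of `K` are those of `G` together with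
the deleted vertex, which is `none`. -/
def PrimitiveDivergent {V : Type u} [Fintype V] (G : SimpleGraph V) : Prop :=
  ∃ K : SimpleGraph (Option V),
    K.Connected ∧ K.IsRegularOfDegree 4 ∧ InternallySixEdgeConnected K ∧
      G = K.comap Option.some

end C2Invariant

/-! Up to sign, `Ψ_G` is the determinant of the matrix with the edge variables on its diagonal,
bordered by an oriented incidence matrix with the column of one root removed (matrix tree theorem,
`det_graphMatrix_incidence`). Let `w` be a neighbour of the deleted vertex. It has degree 3 in `G`;
let `a 0`, `a 1`, `a 2` be its neighbours and take `a 0` as root. Eliminating `w` leaves, up to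
sign, the graph matrix of `G - w` bordered by two rows and columns, whose corner is a generic
symmetric 2 × 2 matrix in the three variables at `w`.

Fix the other variables. Let `d` be the determinant for `G - w`, `W` the block of its adjugate at `a
1, a 2`, and `κ` the bordered determinant with zero corner; then `d * κ = det W`. The three
variables at `w` have exactly `q ^ 2` zeros unless `d = W 0 0 = W 1 1 = 0`, when they have `0` or `q
^ 3`. So `q ^ 2` divides the count, and modulo `q` the quotient is minus the number of these
exceptional points. Where `d = 0`, the relation `W 0 1 ^ 2 = W 0 0 * W 1 1` makes `{d = W 0 1 = 0}`
the union of `{d = W 0 0 = 0}` and `{d = W 1 1 = 0}`, with the exceptional set as intersection. Both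
of the latter counts are divisible by `q`, because `a 2`, respectively `a 1`, has degree 2 or 3 in
`G - w`. Hence `c₂` is the number of common zeros of `d` and `W 0 1` modulo `q`
(`exists_pointCount_eq`).

The degrees of `d` and `W 0 1` are each below the number of variables and add up to at most that
number. By Chevalley–Warning the common zeros are counted modulo `p` by one coefficient of `(d * W 0
1) ^ (q - 1)`, and by Frobenius that coefficient is the `s`-th power of the one for `q = p`
(`coeff_constExp_pow`). The number of variables is odd, so `c₂` at `p ^ s` is `-C ^ s` modulo `p`
with `C` independent of `s`. -/

/-! ### Zero counts of polynomials over finite fields -/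

namespace C2Invariant

open MvPolynomial

/-- The exponent with all entries equal to `k`. -/
noncomputable def constExp (σ : Type*) [Fintype σ] (k : ℕ) : σ →₀ ℕ :=
  Finsupp.equivFunOnFinite.symm fun _ => k

@[simp]
lemma constExp_apply {σ : Type*} [Fintype σ] (k : ℕ) (i : σ) : constExp σ k i = k := rfl

lemma sum_pow_card_sub_one (F : Type*) [Field F] [Fintype F] :
    ∑ x : F, x ^ (Fintype.card F - 1) = -1 := by
  classical
  have h1 : Fintype.card F - 1 ≠ 0 := by have := Fintype.one_lt_card (α := F); omega
  have h2 : ∀ x : F, x ^ (Fintype.card F - 1) = 1 - if x = 0 then 1 else 0 := by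
    intro x
    split_ifs with h
    · simp [h, h1]
    · simp [FiniteField.pow_card_sub_one_eq_one x h]
  simp [h2, Finset.sum_sub_distrib]

lemma sum_prod_pow {F σ : Type*} [Field F] [Fintype F] [Fintype σ] [DecidableEq σ] (m : σ → ℕ) :
    ∑ x : σ → F, ∏ i, x i ^ m i = ∏ i, ∑ a : F, a ^ m i := by
  rw [Finset.prod_univ_sum, Fintype.piFinset_univ]

/-- The sum of `a ^ m` over `F` vanishes for `m < q - 1`, so a monomial survives only if all its
exponents are at least `q - 1`; the degree bound then forces equality everywhere. -/
lemma sum_aeval {k F σ : Type*} [Field k] [Field F] [Fintype F] [Algebra k F] [Fintype σ]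
    [DecidableEq σ] (f : MvPolynomial σ k)
    (hf : f.totalDegree ≤ Fintype.card σ * (Fintype.card F - 1)) :
    ∑ x : σ → F, aeval x f =
      (-1) ^ Fintype.card σ * algebraMap k F (coeff (constExp σ (Fintype.card F - 1)) f) := by
  classical
  set c := constExp σ (Fintype.card F - 1) with hc
  have h1 : ∑ x : σ → F, aeval x f =
      ∑ d ∈ f.support, algebraMap k F (coeff d f) * ∏ i, ∑ a : F, a ^ d i := by
    simp only [aeval_def, eval₂_eq']
    rw [Finset.sum_comm]
    refine Finset.sum_congr rfl fun d _ => ?_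
    rw [← Finset.mul_sum, sum_prod_pow]
  have hcval : ∏ i, ∑ a : F, a ^ c i = (-1) ^ Fintype.card σ := by
    simp [hc, sum_pow_card_sub_one]
  have h2 : ∀ d ∈ f.support, d ≠ c →
      algebraMap k F (coeff d f) * ∏ i, ∑ a : F, a ^ d i = 0 := by
    intro d hd hdc
    obtain ⟨i, hi⟩ : ∃ i, d i < Fintype.card F - 1 := by
      by_contra! h
      apply hdc
      have hle := le_totalDegree hd
      rw [Finsupp.sum_fintype _ _ (fun _ => rfl)] at hle
      have hsum : ∑ i : σ, d i = ∑ _i : σ, (Fintype.card F - 1) := by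
        refine le_antisymm ?_ (Finset.sum_le_sum fun i _ => h i)
        simpa using hle.trans hf
      ext i
      exact (((Finset.sum_eq_sum_iff_of_le fun i _ => h i).1 hsum.symm) i (Finset.mem_univ i)).symm
    rw [Finset.prod_eq_zero (Finset.mem_univ i) (FiniteField.sum_pow_lt_card_sub_one F _ hi),
      mul_zero]
  rw [h1, ← hcval]
  by_cases hcs : c ∈ f.support
  · rw [Finset.sum_eq_single_of_mem c hcs h2, mul_comm]
  · rw [Finset.sum_eq_zero fun d hd => h2 d hd (fun h => hcs (h ▸ hd)),
      notMem_support_iff.1 hcs, map_zero, mul_zero]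

/-- Ax's congruence for polynomials of degree at most the number of variables. -/
lemma natCast_card_zeros {k F σ : Type*} [Field k] [Field F] [Finite F] [Algebra k F]
    [Fintype σ] [Nonempty σ] (f : MvPolynomial σ k) (hf : f.totalDegree ≤ Fintype.card σ) :
    ((Nat.card {x : σ → F // aeval x f = 0} : ℕ) : k) =
      (-1) ^ (Fintype.card σ + 1) *
        coeff (constExp σ (Nat.card F - 1)) (f ^ (Nat.card F - 1)) := by
  classical
  have := Fintype.ofFinite F
  rw [Nat.card_eq_fintype_card (α := F)]
  have h1 : Fintype.card F - 1 ≠ 0 := by have := Fintype.one_lt_card (α := F); omega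
  apply (algebraMap k F).injective
  have h2 := sum_aeval (F := F) (f ^ (Fintype.card F - 1))
    ((totalDegree_pow _ _).trans (by rw [mul_comm]; exact Nat.mul_le_mul_right _ hf))
  have h3 : ∀ x : σ → F, aeval x (f ^ (Fintype.card F - 1)) =
      1 - if aeval x f = 0 then 1 else 0 := by
    intro x
    rw [map_pow]
    split_ifs with h
    · simp [h, h1]
    · simp [FiniteField.pow_card_sub_one_eq_one _ h]
  have h4 : ((Fintype.card (σ → F) : ℕ) : F) = 0 := by
    rw [Fintype.card_fun]
    simp
  simp only [h3, Finset.sum_sub_distrib, Finset.sum_const, Finset.card_univ, nsmul_eq_mul, h4,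
    Finset.sum_boole] at h2
  rw [Nat.card_eq_fintype_card, Fintype.card_subtype, map_natCast, map_mul, pow_succ, map_mul,
    map_pow, map_neg, map_one]
  linear_combination -h2

/-- Induction through `p ^ (s + 1) - 1 = (p - 1) + p * (p ^ s - 1)`. Over the prime field a `p`-th
power is `expand p`, so in a product of monomials giving the target exponent the second factor has
exponents divisible by `p`. Those of the first are then `≡ p - 1` modulo `p`, hence at least `p -
1`, and the degree bound makes them all equal to `p - 1`. -/
lemma coeff_constExp_pow {σ : Type*} [Fintype σ] (p : ℕ) [Fact p.Prime]
    (f : MvPolynomial σ (ZMod p)) (hf : f.totalDegree ≤ Fintype.card σ) (s : ℕ) :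
    coeff (constExp σ (p ^ s - 1)) (f ^ (p ^ s - 1)) =
      coeff (constExp σ (p - 1)) (f ^ (p - 1)) ^ s := by
  classical
  have hp : 1 < p := (Fact.out : p.Prime).one_lt
  induction s with
  | zero =>
    have : constExp σ (p ^ 0 - 1) = 0 := by ext; simp
    rw [this]
    simp
  | succ s ih =>
    have hps : 0 < p ^ s := by positivity
    obtain ⟨r, hr⟩ : ∃ r, p ^ s = r + 1 := ⟨p ^ s - 1, by omega⟩
    obtain ⟨l, rfl⟩ : ∃ l, p = l + 1 := ⟨p - 1, by omega⟩
    have hexp : (l + 1) ^ (s + 1) - 1 = l + (l + 1) * r := by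
      rw [pow_succ, hr]; ring_nf; omega
    rw [hr] at ih
    simp only [Nat.add_sub_cancel] at ih ⊢
    rw [hexp, pow_add, mul_comm (l + 1) r, pow_mul, ← expand_zmod, pow_succ, ← ih, coeff_mul]
    have hmem : (constExp σ l, (l + 1) • constExp σ r) ∈
        Finset.HasAntidiagonal.antidiagonal (constExp σ (l + r * (l + 1))) := by
      rw [Finset.HasAntidiagonal.mem_antidiagonal]
      ext i
      simp [mul_comm]
    rw [Finset.sum_eq_single_of_mem _ hmem]
    · rw [coeff_expand_smul _ (by omega), mul_comm]
    · rintro ⟨a, b⟩ hab hne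
      rw [Finset.HasAntidiagonal.mem_antidiagonal] at hab
      have habi : ∀ i, a i + b i = l + r * (l + 1) := fun i => by
        simpa using DFunLike.congr_fun hab i
      by_contra hnz
      have ha : coeff a (f ^ l) ≠ 0 := left_ne_zero_of_mul hnz
      have hb := right_ne_zero_of_mul hnz
      have hdvd : ∀ i, (l + 1) ∣ b i := fun i => by
        by_contra h
        exact hb (coeff_expand_of_not_dvd _ h)
      have hla : ∀ i, l ≤ a i := by
        intro i
        obtain ⟨t, ht⟩ := hdvd i
        have h := habi i
        rw [ht] at h
        by_contra! hlt
        have h5 : (l + 1) * t < (l + 1) * (r + 1) := by nlinarith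
        have h6 : t ≤ r := by have := lt_of_mul_lt_mul_left h5 (Nat.zero_le _); omega
        nlinarith
      have hdeg : ∑ i, a i ≤ Fintype.card σ * l := by
        have h := le_totalDegree (mem_support_iff.2 ha)
        rw [Finsupp.sum_fintype _ _ (fun _ => rfl)] at h
        exact h.trans ((totalDegree_pow _ _).trans
          (by rw [mul_comm]; exact Nat.mul_le_mul_right _ hf))
      have hal : a = constExp σ l := by
        have hsum : ∑ _i : σ, l = ∑ i : σ, a i :=
          le_antisymm (Finset.sum_le_sum fun i _ => hla i) (by simpa using hdeg)
        ext i
        exact (((Finset.sum_eq_sum_iff_of_le fun i _ => hla i).1 hsum) i (Finset.mem_univ i)).symm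
      apply hne
      rw [Prod.mk.injEq]
      refine ⟨hal, ?_⟩
      ext i
      have h := habi i
      rw [hal, constExp_apply] at h
      simp only [Finsupp.smul_apply, constExp_apply, smul_eq_mul]
      linarith

/-- For polynomials `d`, `s` whose degrees are smaller than the number of variables and add up to
at most that number, the number of common zeros modulo `p` over all finite extensions of the prime
field is controlled by a single coefficient. -/
lemma natCast_card_common_zeros {σ : Type*} [Fintype σ] (p : ℕ) [Fact p.Prime]
    {F : Type*} [Field F] [Finite F] [Algebra (ZMod p) F] (n : ℕ) (hn : Nat.card F = p ^ n)
    (d s : MvPolynomial σ (ZMod p)) (hd : d.totalDegree < Fintype.card σ)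
    (hs : s.totalDegree < Fintype.card σ)
    (hds : d.totalDegree + s.totalDegree ≤ Fintype.card σ) :
    ((Nat.card {x : σ → F // aeval x d = 0 ∧ aeval x s = 0} : ℕ) : ZMod p) =
      (-1) ^ Fintype.card σ * coeff (constExp σ (p - 1)) ((d * s) ^ (p - 1)) ^ n := by
  classical
  have := Fintype.ofFinite F
  have : Nonempty σ := Fintype.card_pos_iff.1 (by omega)
  have hF1 : 0 < Nat.card F - 1 := by have := Finite.one_lt_card (α := F); omega
  -- Chevalley–Warning: the degree of `g ^ (q - 1)` is too small to contain the constant exponent `q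
  -- - 1`.
  have hsmall : ∀ g : MvPolynomial σ (ZMod p), g.totalDegree < Fintype.card σ →
      ((Nat.card {x : σ → F // aeval x g = 0} : ℕ) : ZMod p) = 0 := by
    intro g hg
    rw [natCast_card_zeros g hg.le, coeff_eq_zero_of_totalDegree_lt, mul_zero]
    refine (totalDegree_pow _ _).trans_lt ?_
    have : ∑ i ∈ (constExp σ (Nat.card F - 1)).support, constExp σ (Nat.card F - 1) i =
        (constExp σ (Nat.card F - 1)).sum fun _ e => e := rfl
    rw [this, Finsupp.sum_fintype _ _ (fun _ => rfl)]
    simp only [constExp_apply, Finset.sum_const, Finset.card_univ, smul_eq_mul]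
    rw [mul_comm]
    exact Nat.mul_lt_mul_of_pos_right hg hF1
  have hprod := natCast_card_zeros (F := F) (d * s) ((totalDegree_mul _ _).trans hds)
  rw [hn, coeff_constExp_pow p (d * s) ((totalDegree_mul _ _).trans hds)] at hprod
  have hcount : Nat.card {x : σ → F // aeval x (d * s) = 0} +
      Nat.card {x : σ → F // aeval x d = 0 ∧ aeval x s = 0} =
      Nat.card {x : σ → F // aeval x d = 0} + Nat.card {x : σ → F // aeval x s = 0} := by
    simp only [Nat.card_eq_fintype_card, Fintype.card_subtype, map_mul, mul_eq_zero]
    rw [Finset.filter_or, Finset.filter_and]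
    exact Finset.card_union_add_card_inter _ _
  have hcast := congrArg (Nat.cast (R := ZMod p)) hcount
  rw [Nat.cast_add, Nat.cast_add, hsmall d hd, hsmall s hs, hprod] at hcast
  rw [pow_succ] at hcast
  linear_combination hcast

end C2Invariant

/-! ### Bordered determinants -/

namespace C2Invariant

open Matrix

section Bordered

variable {R : Type*} [CommRing R] {n m : Type*} [Fintype n] [DecidableEq n] [Fintype m]
  [DecidableEq m]

/-- The Schur complement with denominators cleared: the adjugate replaces the inverse, so no
invertibility is needed, at the price of a power of `Q.det`. -/
lemma det_fromBlocks_mul_det_pow (A : Matrix m m R) (U : Matrix m n R) (L : Matrix n m R)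
    (Q : Matrix n n R) :
    (fromBlocks A U L Q).det * Q.det ^ Fintype.card m =
      (Q.det • A - U * Q.adjugate * L).det * Q.det := by
  have h : fromBlocks A U L Q * fromBlocks (Q.det • (1 : Matrix m m R)) 0 (-(Q.adjugate * L)) 1 =
      fromBlocks (Q.det • A - U * Q.adjugate * L) U 0 Q := by
    rw [fromBlocks_multiply]
    congr 1
    · simp [sub_eq_add_neg, Matrix.mul_assoc]
    · simp
    · rw [Matrix.mul_neg, ← Matrix.mul_assoc, mul_adjugate]
      simp
    · simp
  have h2 := congrArg det h
  rw [det_mul, det_fromBlocks_zero₁₂, det_fromBlocks_zero₂₁, det_smul, det_one, det_one, mul_one,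
    mul_one] at h2
  exact h2

lemma det_fromBlocks_of_isRegular (A : Matrix (Fin 2) (Fin 2) R) (U : Matrix (Fin 2) n R)
    (L : Matrix n (Fin 2) R) (Q : Matrix n n R) (hQ : IsRegular Q.det) :
    (fromBlocks A U L Q).det * Q.det = (Q.det • A - U * Q.adjugate * L).det := by
  have h := det_fromBlocks_mul_det_pow A U L Q
  rw [Fintype.card_fin, pow_two, ← mul_assoc] at h
  exact hQ.right h

/-- The bordered determinant by two rows and columns, as a function of the corner. -/
def borderPoly (A : Matrix (Fin 2) (Fin 2) R) (W : Matrix (Fin 2) (Fin 2) R) (d κ : R) : R :=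
  d * A.det - (A 0 0 * W 1 1 + A 1 1 * W 0 0 - A 0 1 * W 1 0 - A 1 0 * W 0 1) + κ

/-- After multiplication by `Q.det`, subtracting the case of zero corner removes the term `det (U *
adj Q * L)`; all that is left is divisible by `Q.det`, which can be cancelled. -/
lemma det_fromBlocks_eq_of_isRegular (A : Matrix (Fin 2) (Fin 2) R) (U : Matrix (Fin 2) n R)
    (L : Matrix n (Fin 2) R) (Q : Matrix n n R) (hQ : IsRegular Q.det) :
    (fromBlocks A U L Q).det =
      borderPoly A (U * Q.adjugate * L) Q.det (fromBlocks 0 U L Q).det := by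
  apply hQ.right
  have h0 := det_fromBlocks_of_isRegular 0 U L Q hQ
  have h := det_fromBlocks_of_isRegular A U L Q hQ
  simp only [borderPoly]
  rw [add_mul, h0, h]
  simp only [det_fin_two, smul_zero, zero_sub, Matrix.neg_apply, Matrix.sub_apply,
    Matrix.smul_apply, smul_eq_mul]
  ring

open Polynomial in
-- The lift is `X + Q`, whose determinant is monic. Identities proved for regular `Q.det` thus hold
-- for every `Q` after setting `X = 0`.
lemma exists_regular_lift (Q : Matrix n n R) : ∃ Q' : Matrix n n R[X],
    IsRegular Q'.det ∧ Q'.map (evalRingHom (0 : R)) = Q := by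
  refine ⟨charmatrix (-Q), (Matrix.charpoly_monic (-Q)).isRegular, ?_⟩
  ext i j
  by_cases h : i = j
  · subst h; simp [charmatrix_apply_eq]
  · simp [charmatrix_apply_ne _ _ _ h]

open Polynomial in
lemma map_eval_map_C {k l : Type*} (A : Matrix k l R) :
    (A.map (C : R →+* R[X])).map (evalRingHom (0 : R)) = A := by
  ext i j; simp

open Polynomial in
/-- The Desnanot–Jacobi identity for a matrix bordered by two rows and columns. -/
lemma det_fromBlocks_mul_det (A : Matrix (Fin 2) (Fin 2) R) (U : Matrix (Fin 2) n R)
    (L : Matrix n (Fin 2) R) (Q : Matrix n n R) :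
    (fromBlocks A U L Q).det * Q.det = (Q.det • A - U * Q.adjugate * L).det := by
  obtain ⟨Q', hreg, hQ'⟩ := exists_regular_lift Q
  have h := congrArg (evalRingHom (0 : R)) (det_fromBlocks_of_isRegular (A.map C) (U.map C)
    (L.map C) Q' hreg)
  rw [map_mul, RingHom.map_det, RingHom.map_det, RingHom.map_det, RingHom.mapMatrix_apply,
    RingHom.mapMatrix_apply, RingHom.mapMatrix_apply, fromBlocks_map, map_eval_map_C,
    map_eval_map_C, map_eval_map_C, hQ'] at h
  rw [h, ← RingHom.mapMatrix_apply, map_sub, RingHom.mapMatrix_apply, RingHom.mapMatrix_apply,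
    Matrix.map_mul, Matrix.map_mul, map_eval_map_C, map_eval_map_C]
  have h1 : Q'.adjugate.map (evalRingHom (0 : R)) = Q.adjugate := by
    rw [← RingHom.mapMatrix_apply, RingHom.map_adjugate, RingHom.mapMatrix_apply, hQ']
  have h2 : (evalRingHom (0 : R)) Q'.det = Q.det := by
    rw [RingHom.map_det, RingHom.mapMatrix_apply, hQ']
  rw [h1]
  congr 2
  rw [← h2]
  ext i j
  simp

open Polynomial in
lemma det_fromBlocks_eq_borderPoly (A : Matrix (Fin 2) (Fin 2) R) (U : Matrix (Fin 2) n R)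
    (L : Matrix n (Fin 2) R) (Q : Matrix n n R) :
    (fromBlocks A U L Q).det =
      borderPoly A (U * Q.adjugate * L) Q.det (fromBlocks 0 U L Q).det := by
  obtain ⟨Q', hreg, hQ'⟩ := exists_regular_lift Q
  have h := congrArg (evalRingHom (0 : R)) (det_fromBlocks_eq_of_isRegular (A.map C) (U.map C)
    (L.map C) Q' hreg)
  have h1 : (U.map C * Q'.adjugate * L.map C).map (evalRingHom (0 : R)) = U * Q.adjugate * L := by
    rw [Matrix.map_mul, Matrix.map_mul, map_eval_map_C, map_eval_map_C, ← RingHom.mapMatrix_apply,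
      RingHom.map_adjugate, RingHom.mapMatrix_apply, hQ']
  have h1' : ∀ i j, evalRingHom (0 : R) ((U.map C * Q'.adjugate * L.map C) i j) =
      (U * Q.adjugate * L) i j := fun i j => congrFun (congrFun h1 i) j
  have h2 : (evalRingHom (0 : R)) Q'.det = Q.det := by
    rw [RingHom.map_det, RingHom.mapMatrix_apply, hQ']
  have h3 : (evalRingHom (0 : R)) (A.map C).det = A.det := by
    rw [RingHom.map_det, RingHom.mapMatrix_apply, map_eval_map_C]
  simp only [borderPoly, map_add, map_sub, map_mul, h1', h2, h3] at h
  rw [RingHom.map_det, RingHom.map_det, RingHom.mapMatrix_apply, RingHom.mapMatrix_apply,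
    fromBlocks_map, fromBlocks_map, map_eval_map_C, map_eval_map_C, map_eval_map_C, hQ'] at h
  rw [h]
  simp [borderPoly]

end Bordered

/-! ### Zero counts for bordered determinants -/

section Count

variable {F : Type*} [Field F]

/-- The cone `a * c = b ^ 2` is parametrised by `(c, b)` where `c ≠ 0` and by `a` where `c = 0`,
since then `b = 0`. This works in every characteristic. -/
lemma card_mul_eq_sq :
    Nat.card {t : F × F × F // t.1 * t.2.2 = t.2.1 ^ 2} = Nat.card F ^ 2 := by
  classical
  rw [pow_two, ← Nat.card_prod]
  refine Nat.card_congr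
    { toFun := fun t => (t.1.2.2, if t.1.2.2 = 0 then t.1.1 else t.1.2.1)
      invFun := fun t => if h : t.1 = 0 then ⟨(t.2, 0, 0), by simp⟩ else
        ⟨(t.2 ^ 2 / t.1, t.2, t.1), by field_simp⟩
      left_inv := ?_
      right_inv := ?_ }
  · rintro ⟨⟨a, b, c⟩, h⟩
    by_cases hc : c = 0
    · subst hc
      simp only [mul_zero] at h
      have hb : b = 0 := by simpa using h.symm
      simp [hb]
    · simp only at h
      simp only [hc, if_false, dif_neg, not_false_eq_true, Subtype.mk.injEq, Prod.mk.injEq,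
        and_true]
      rw [← h]; field_simp
  · rintro ⟨x, y⟩
    by_cases hx : x = 0 <;> simp [hx]

/-- The corner of a bordered determinant which arises from a trivalent vertex. -/
def corner {R : Type*} [Semiring R] (η : R) (x : Fin 3 → R) : Matrix (Fin 2) (Fin 2) R :=
  !![x 0 + x 1, η * x 0; η * x 0, x 0 + x 2]

/-- The corner matrices are the symmetric `2 × 2` matrices. -/
def cornerEquiv (η : F) (hη : η * η = 1) : (Fin 3 → F) ≃ F × F × F where
  toFun x := (x 0 + x 1, η * x 0, x 0 + x 2)
  invFun t := ![η * t.2.1, t.1 - η * t.2.1, t.2.2 - η * t.2.1]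
  left_inv x := by
    have h : η * (η * x 0) = x 0 := by rw [← mul_assoc, hη, one_mul]
    ext i
    fin_cases i <;> simp [h]
  right_inv t := by
    have h : η * (η * t.2.1) = t.2.1 := by rw [← mul_assoc, hη, one_mul]
    ext <;> simp [h]

lemma card_corner_zeros (η : F) (hη : η * η = 1) (W : Matrix (Fin 2) (Fin 2) F)
    (hW : W 0 1 = W 1 0) (d κ : F) :
    Nat.card {x : Fin 3 → F // borderPoly (corner η x) W d κ = 0} =
      Nat.card {t : F × F × F // d * (t.1 * t.2.2 - t.2.1 ^ 2) -
        (t.1 * W 1 1 + t.2.2 * W 0 0 - 2 * t.2.1 * W 0 1) + κ = 0} := by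
  refine Nat.card_congr ((cornerEquiv η hη).subtypeEquiv fun x => ?_)
  simp only [borderPoly, corner, cornerEquiv, det_fin_two, Equiv.coe_fn_mk, hW]
  simp only [of_apply, cons_val', cons_val_zero, cons_val_one, cons_val_fin_one]
  refine Eq.congr ?_ rfl
  ring

/-- The number of zeros in the generic case. -/
lemma card_corner_zeros_of_ne (η : F) (hη : η * η = 1) (W : Matrix (Fin 2) (Fin 2) F)
    (hW : W 0 1 = W 1 0) (d κ : F) (hκ : d * κ = W.det)
    (h : ¬ (d = 0 ∧ W 0 0 = 0 ∧ W 1 1 = 0)) :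
    Nat.card {x : Fin 3 → F // borderPoly (corner η x) W d κ = 0} = Nat.card F ^ 2 := by
  rw [card_corner_zeros η hη W hW]
  rw [det_fin_two, ← hW] at hκ
  by_cases hd : d = 0
  · subst hd
    by_cases h1 : W 1 1 = 0
    · have h0 : W 0 0 ≠ 0 := fun h0 => h ⟨rfl, h0, h1⟩
      rw [pow_two, ← Nat.card_prod]
      refine Nat.card_congr
        { toFun := fun t => (t.1.1, t.1.2.1)
          invFun := fun t => ⟨(t.1, t.2, (κ + 2 * t.2 * W 0 1) / W 0 0), by
            simp only [h1]; field_simp; ring⟩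
          left_inv := ?_
          right_inv := fun t => rfl }
      rintro ⟨⟨a, b, c⟩, ht⟩
      simp only [Subtype.mk.injEq, Prod.mk.injEq, true_and]
      simp only [h1] at ht
      field_simp
      linear_combination ht
    · rw [pow_two, ← Nat.card_prod]
      refine Nat.card_congr
        { toFun := fun t => (t.1.2.2, t.1.2.1)
          invFun := fun t => ⟨((κ + 2 * t.2 * W 0 1 - t.1 * W 0 0) / W 1 1, t.2, t.1), by
            simp only; field_simp; ring⟩
          left_inv := ?_
          right_inv := fun t => rfl }
      rintro ⟨⟨a, b, c⟩, ht⟩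
      simp only [Subtype.mk.injEq, Prod.mk.injEq, and_true]
      simp only at ht
      field_simp
      linear_combination ht
  -- For `d ≠ 0` the substitution `A ↦ d • A - W` carries the zero set onto the cone, because `d * κ
  -- = det W` gives `det (d • A - W) = d * borderPoly A W d κ` for symmetric `A`. For `d = 0`,
  -- treated above, the equation is linear in the corner with a nonzero coefficient.
  · rw [← card_mul_eq_sq]
    refine Nat.card_congr (Equiv.subtypeEquiv
      { toFun := fun t => (d * t.1 - W 0 0, d * t.2.1 - W 0 1, d * t.2.2 - W 1 1)
        invFun := fun t => ((t.1 + W 0 0) / d, (t.2.1 + W 0 1) / d, (t.2.2 + W 1 1) / d)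
        left_inv := fun t => by ext <;> simp [hd]
        right_inv := fun t => by ext <;> simp [mul_div_cancel₀, hd] } fun t => ?_)
    simp only [Equiv.coe_fn_mk]
    rw [← mul_right_inj' hd, mul_zero, ← sub_eq_zero (b := (_ : F) ^ 2)]
    refine Eq.congr ?_ rfl
    linear_combination hκ

/-- Here `det W = 0` also forces `W 0 1 = 0`, so the polynomial is the constant `κ` and has either
all `q ^ 3` points or none as zeros. -/
lemma card_corner_zeros_of_eq (η : F) (W : Matrix (Fin 2) (Fin 2) F)
    (hW : W 0 1 = W 1 0) (d κ : F) (hκ : d * κ = W.det)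
    (h : d = 0 ∧ W 0 0 = 0 ∧ W 1 1 = 0) :
    Nat.card F ^ 3 ∣ Nat.card {x : Fin 3 → F // borderPoly (corner η x) W d κ = 0} := by
  obtain ⟨hd, h0, h1⟩ := h
  rw [det_fin_two, ← hW, hd, h0, h1] at hκ
  have h01 : W 0 1 = 0 := by
    have : W 0 1 * W 0 1 = 0 := by linear_combination hκ
    simpa using this
  have h2 : ∀ x, borderPoly (corner η x) W d κ = κ := fun x => by
    simp [borderPoly, hd, h0, h1, ← hW, h01]
  simp only [h2]
  by_cases hk : κ = 0
  · simp [hk, Nat.card_fun]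
  · simp [hk]

lemma sq_dvd_card_corner_zeros (η : F) (hη : η * η = 1) (W : Matrix (Fin 2) (Fin 2) F)
    (hW : W 0 1 = W 1 0) (d κ : F) (hκ : d * κ = W.det) :
    Nat.card F ^ 2 ∣ Nat.card {x : Fin 3 → F // borderPoly (corner η x) W d κ = 0} := by
  by_cases h : d = 0 ∧ W 0 0 = 0 ∧ W 1 1 = 0
  · exact (pow_dvd_pow _ (by norm_num)).trans (card_corner_zeros_of_eq η W hW d κ hκ h)
  · rw [card_corner_zeros_of_ne η hη W hW d κ hκ h]

end Count

end C2Invariant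

/-! ### Elimination of a vertex of small degree -/

namespace C2Invariant

open Matrix

section Star

variable {R : Type*} [CommRing R] {n ι : Type*} [Fintype n] [DecidableEq n] [Fintype ι]
  [DecidableEq ι]

/-- The border obtained by eliminating a trivalent vertex, where `u k` is the row of the `k`-th
edge at this vertex. -/
def starBorder (ε : Fin 3 → R) (u : Fin 3 → n → R) : Matrix (Fin 2) n R :=
  of fun k i => u k.succ i - ε 0 * ε k.succ * u 0 i

/-- Schur complement with respect to the block of the first edge and the vertex. That block has
determinant `-ε 0 ^ 2 = -1` whatever `x 0` is, so nothing is divided by a variable. -/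
lemma det_star (x ε : Fin 3 → R) (u : Fin 3 → n → R) (Q : Matrix n n R)
    (hε : ∀ k, ε k * ε k = 1) :
    (fromBlocks !![x 0, ε 0; ε 0, 0]
      (of ![Sum.elim 0 (u 0), Sum.elim ![ε 1, ε 2] 0])
      (of ![Sum.elim 0 (u 0), Sum.elim ![ε 1, ε 2] 0])ᵀ
      (fromBlocks !![x 1, 0; 0, x 2] (of ![u 1, u 2]) (of ![u 1, u 2])ᵀ Q)).det =
    -(fromBlocks (corner (ε 1 * ε 2) x) (starBorder ε u) (starBorder ε u)ᵀ Q).det := by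
  set P : Matrix (Fin 2) (Fin 2) R := !![x 0, ε 0; ε 0, 0] with hP
  set P' : Matrix (Fin 2) (Fin 2) R := !![0, ε 0; ε 0, -x 0] with hP'
  have h0 := hε 0
  have h1 := hε 1
  have h2 := hε 2
  have hPP' : P * P' = 1 := by
    ext i j
    fin_cases i <;> fin_cases j <;> simp [P, P', Matrix.mul_apply, Fin.sum_univ_two, h0]
    ring
  have hP'P : P' * P = 1 := by
    ext i j
    fin_cases i <;> fin_cases j <;> simp [P, P', Matrix.mul_apply, Fin.sum_univ_two, h0]
    ring
  let _ : Invertible P := ⟨P', hP'P, hPP'⟩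
  have hinv : ⅟P = P' := rfl
  rw [det_fromBlocks₁₁, hinv]
  have hdet : P.det = -1 := by
    rw [hP, det_fin_two]
    simp [h0]
  rw [hdet, neg_one_mul]
  congr 2
  ext (i | i) (j | j)
  · fin_cases i <;> fin_cases j <;>
      simp [P', Matrix.mul_apply, Fin.sum_univ_two, corner]
    · linear_combination x 0 * h1
    · ring
    · ring
    · linear_combination x 0 * h2
  · fin_cases i <;> simp [P', Matrix.mul_apply, Fin.sum_univ_two, starBorder] <;> ring
  · fin_cases j <;> simp [P', Matrix.mul_apply, Fin.sum_univ_two, starBorder] <;> ring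
  · simp [P', Matrix.mul_apply, Fin.sum_univ_two]

/-- The positions of the three edges at a trivalent vertex. -/
def starPos (f : Fin 2 ⊕ (Fin 2 ⊕ n) ≃ ι) : Fin 3 → ι :=
  ![f (.inl 0), f (.inr (.inl 0)), f (.inr (.inl 1))]

lemma det_of_star (N : Matrix ι ι R) (hN : N.IsSymm) (f : Fin 2 ⊕ (Fin 2 ⊕ n) ≃ ι)
    (x ε : Fin 3 → R) (hε : ∀ k, ε k * ε k = 1)
    (hpos : ∀ k l, N (starPos f k) (starPos f l) = if k = l then x k else 0)
    (hww : N (f (.inl 1)) (f (.inl 1)) = 0)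
    (hw : ∀ k, N (f (.inl 1)) (starPos f k) = ε k)
    (hw0 : ∀ i, N (f (.inl 1)) (f (.inr (.inr i))) = 0) :
    N.det = -(fromBlocks (corner (ε 1 * ε 2) x)
      (starBorder ε fun k i => N (starPos f k) (f (.inr (.inr i))))
      (starBorder ε fun k i => N (starPos f k) (f (.inr (.inr i))))ᵀ
      (N.submatrix (fun i => f (.inr (.inr i))) fun i => f (.inr (.inr i)))).det := by
  rw [← det_star x ε _ _ hε, ← det_submatrix_equiv_self f N]
  have hs : ∀ i j, N i j = N j i := fun i j => hN.apply j i
  have p00 : N (f (.inl 0)) (f (.inl 0)) = x 0 := by simpa [starPos] using hpos 0 0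
  have p01 : N (f (.inl 0)) (f (.inr (.inl 0))) = 0 := by simpa [starPos] using hpos 0 1
  have p02 : N (f (.inl 0)) (f (.inr (.inl 1))) = 0 := by simpa [starPos] using hpos 0 2
  have p11 : N (f (.inr (.inl 0))) (f (.inr (.inl 0))) = x 1 := by simpa [starPos] using hpos 1 1
  have p12 : N (f (.inr (.inl 0))) (f (.inr (.inl 1))) = 0 := by simpa [starPos] using hpos 1 2
  have p22 : N (f (.inr (.inl 1))) (f (.inr (.inl 1))) = x 2 := by simpa [starPos] using hpos 2 2
  have w0 : N (f (.inl 1)) (f (.inl 0)) = ε 0 := by simpa [starPos] using hw 0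
  have w1 : N (f (.inl 1)) (f (.inr (.inl 0))) = ε 1 := by simpa [starPos] using hw 1
  have w2 : N (f (.inl 1)) (f (.inr (.inl 1))) = ε 2 := by simpa [starPos] using hw 2
  have p10 := (hs _ _).trans p01
  have p20 := (hs _ _).trans p02
  have p21 := (hs _ _).trans p12
  have w0' := (hs _ _).trans w0
  have w1' := (hs _ _).trans w1
  have w2' := (hs _ _).trans w2
  have hw0' : ∀ i, N (f (.inr (.inr i))) (f (.inl 1)) = 0 := fun i => (hs _ _).trans (hw0 i)
  congr 1
  ext (i | i | i) (j | j | j)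
  · fin_cases i <;> fin_cases j <;> simp [p00, w0, w0', hww]
  · fin_cases i <;> fin_cases j <;> simp [p01, p02, w1, w2]
  · fin_cases i <;> simp [hw0, starPos]
  · fin_cases i <;> fin_cases j <;> simp [p10, p20, w1', w2']
  · fin_cases i <;> fin_cases j <;> simp [p11, p12, p21, p22]
  · fin_cases i <;> simp [starPos]
  · fin_cases j <;> simp [hw0', starPos, hs]
  · fin_cases j <;> simp [starPos, hs]
  · simp

/-- Moving weight between the two edges at a bivalent vertex does not change the determinant. -/
lemma det_eq_of_bivalent (N N' : Matrix ι ι R) (hN : N.IsSymm) {w i₁ i₂ : ι} (h12 : i₁ ≠ i₂)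
    (h1w : i₁ ≠ w) (h2w : i₂ ≠ w) (ε₁ ε₂ t : R) (hε₁ : ε₁ * ε₁ = 1) (hε₂ : ε₂ * ε₂ = 1)
    (hw1 : N w i₁ = ε₁) (hw2 : N w i₂ = ε₂) (hw0 : ∀ i, i ≠ i₁ → i ≠ i₂ → N w i = 0)
    (h11 : N' i₁ i₁ = N i₁ i₁ + t) (h22 : N' i₂ i₂ = N i₂ i₂ - t)
    (h : ∀ i j, ¬ (i = i₁ ∧ j = i₁) → ¬ (i = i₂ ∧ j = i₂) → N' i j = N i j) :
    N'.det = N.det := by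
  have hs : ∀ i j, N i j = N j i := fun i j => hN.apply j i
  -- Adding `t * ε₁` times row `w` to row `i₁` adds `t` at `(i₁, i₁)` and `t * ε₁ * ε₂` at `(i₁,
  -- i₂)`. Subtracting `t * ε₂` times column `w` from column `i₂` cancels the latter and subtracts
  -- `t` at `(i₂, i₂)`.
  set N₁ := N.updateRow i₁ (N i₁ + (t * ε₁) • N w) with hN₁
  have hww : N w w = 0 := hw0 w h1w.symm h2w.symm
  have hcol : ∀ i, N₁ i w = N w i := by
    intro i
    by_cases hi : i = i₁
    · subst hi; simp [N₁, hww, hs]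
    · simp [N₁, hi, hs i w]
  have h2 : N' = N₁.updateCol i₂ (fun k => N₁ k i₂ + (-(t * ε₂)) • N₁ k w) := by
    ext i j
    rw [updateCol_apply]
    simp only [hcol]
    by_cases hj : j = i₂
    · subst hj
      by_cases hi : i = i₁
      · subst hi
        simp only [N₁, updateRow_self, Pi.add_apply, Pi.smul_apply, smul_eq_mul, hw1, hw2]
        rw [h _ _ (by tauto) (by tauto)]
        simp only [if_true]
        ring
      · by_cases hi2 : i = j
        · subst hi2
          simp only [N₁, updateRow_ne hi, hw2, h22, smul_eq_mul]
          simp only [if_true]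
          linear_combination t * hε₂
        · rw [h _ _ (by tauto) (by tauto)]
          simp [N₁, updateRow_ne hi, hw0 i hi hi2]
    · by_cases hi : i = i₁
      · subst hi
        by_cases hj1 : j = i
        · subst hj1
          simp only [N₁, updateRow_self, Pi.add_apply, Pi.smul_apply, smul_eq_mul, hw1, h11, hj,
            if_false]
          linear_combination -t * hε₁
        · rw [h _ _ (by tauto) (by tauto)]
          simp [N₁, hj, hw0 j hj1 hj]
      · rw [h _ _ (by tauto) (by tauto)]
        simp [N₁, hj, hi]
  rw [h2, det_updateCol_add_smul_self _ h2w, hN₁, det_updateRow_add_smul_self _ h1w]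

end Star

end C2Invariant

/-! ### Common zeros of a determinant and a principal minor -/

namespace C2Invariant

open Matrix

section Fibers

variable {F : Type*} [Finite F]

lemma card_eq_sum_fibers {A B E : Type*} [Finite A] [Fintype (B → F)] (k : A ⊕ B ≃ E)
    (P : (E → F) → Prop) :
    Nat.card {y // P y} =
      ∑ z : B → F, Nat.card {x : A → F // P (Sum.elim x z ∘ k.symm)} := by
  rw [← Nat.card_sigma]
  refine Nat.card_congr
    { toFun := fun y => ⟨fun b => y.1 (k (.inr b)), fun a => y.1 (k (.inl a)), ?_⟩
      invFun := fun t => ⟨Sum.elim t.2.1 t.1 ∘ k.symm, t.2.2⟩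
      left_inv := ?_
      right_inv := ?_ }
  · convert y.2 using 1
    ext e
    obtain ⟨e, rfl⟩ := k.surjective e
    rcases e with e | e <;> simp
  · rintro ⟨y, hy⟩
    ext e
    obtain ⟨e, rfl⟩ := k.surjective e
    rcases e with e | e <;> simp
  · rintro ⟨z, x, hx⟩
    have h1 : (fun b => (Sum.elim x z ∘ k.symm) (k (.inr b))) = z := by ext; simp
    have h2 : (fun a => (Sum.elim x z ∘ k.symm) (k (.inl a))) = x := by ext; simp
    refine Sigma.ext h1 ?_
    rw [Subtype.heq_iff_coe_eq]
    · exact h2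
    · intro x'; simp only [h1]

lemma dvd_card_of_fibers {A B E : Type*} [Finite A] [Finite B] (k : A ⊕ B ≃ E)
    (P : (E → F) → Prop) (m : ℕ)
    (h : ∀ z : B → F, m ∣ Nat.card {x : A → F // P (Sum.elim x z ∘ k.symm)}) :
    m ∣ Nat.card {y // P y} := by
  have := Fintype.ofFinite (B → F)
  rw [card_eq_sum_fibers k]
  exact Finset.dvd_sum fun z _ => h z

end Fibers

section Field

variable {F : Type*} [Field F]

/-- The additive group of `F` acts freely on the solutions by these shifts, and every orbit meets `y
e₁ = 0` exactly once. -/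
lemma card_dvd_card_of_shift {E : Type*} {e₁ e₂ : E} (h12 : e₁ ≠ e₂)
    (P : (E → F) → Prop)
    (h : ∀ y y' : E → F, ∀ t, y' e₁ = y e₁ + t → y' e₂ = y e₂ - t →
      (∀ e, e ≠ e₁ → e ≠ e₂ → y' e = y e) → P y → P y') :
    Nat.card F ∣ Nat.card {y // P y} := by
  classical
  let sh : F → (E → F) → E → F := fun t y e => if e = e₁ then y e + t else
    if e = e₂ then y e - t else y e
  have hsh : ∀ t y, P y → P (sh t y) := fun t y hy =>
    h y _ t (by simp [sh]) (by simp [sh, h12.symm]) (fun e h1 h2 => by simp [sh, h1, h2]) hy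
  have heq : Nat.card {y // P y} = Nat.card (F × {y : E → F // P y ∧ y e₁ = 0}) := by
    refine Nat.card_congr
      { toFun := fun y => (y.1 e₁, ⟨sh (-y.1 e₁) y.1, hsh _ _ y.2, by simp [sh]⟩)
        invFun := fun t => ⟨sh t.1 t.2.1, hsh _ _ t.2.2.1⟩
        left_inv := ?_
        right_inv := ?_ }
    · rintro ⟨y, hy⟩
      ext e
      simp only [sh]
      split_ifs <;> simp
    · rintro ⟨t, y, hy, hy0⟩
      ext e
      · simp [sh, hy0]
      · simp only [sh, if_true, hy0, zero_add]
        split_ifs <;> simp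
  rw [heq, Nat.card_prod]
  exact dvd_mul_right _ _

/-- A point with `b y ≠ 0` lies on exactly one member of the pencil; a point with `b y = 0` lies on
all of them or on none, according to whether `a y = 0`. -/
lemma sum_card_pencil [Finite F] {Y : Type*} [Finite Y] [Fintype F] (a b : Y → F) :
    ∑ t : F, Nat.card {y // a y + t * b y = 0} =
      Nat.card F * Nat.card {y // a y = 0 ∧ b y = 0} + Nat.card {y // b y ≠ 0} := by
  classical
  rw [← Nat.card_sigma, ← Nat.card_prod, ← Nat.card_sum]
  refine Nat.card_congr
    { toFun := fun s => if h : b s.2.1 = 0 then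
        .inl (s.1, ⟨s.2.1, by simpa [h] using s.2.2, h⟩) else .inr ⟨s.2.1, h⟩
      invFun := Sum.elim (fun s => ⟨s.1, s.2.1, by simp [s.2.2.1, s.2.2.2]⟩)
        (fun y => ⟨-a y.1 / b y.1, y.1, by have := y.2; field_simp; ring⟩)
      left_inv := ?_
      right_inv := ?_ }
  · rintro ⟨t, y, hy⟩
    by_cases h : b y = 0
    · simp [h]
    · have ht : -a y / b y = t := by
        field_simp
        linear_combination -hy
      subst ht
      simp [h]
  · rintro (⟨t, y, hy⟩ | ⟨y, hy⟩)
    · simp [hy.2]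
    · simp [hy]

/-- The matrices `N y` contain the star of a trivalent vertex `w`: its edges carry the variables
`g k`, which enter only through the diagonal entries at the indices `pos k`. -/
structure IsTrivalent {E ι : Type*} (N : (E → F) → Matrix ι ι F) (g : Fin 3 → E)
    (pos : Fin 3 → ι) (w : ι) (ε : Fin 3 → F) : Prop where
  injective_var : Function.Injective g
  injective_pos : Function.Injective pos
  pos_ne : ∀ k, pos k ≠ w
  sign : ∀ k, ε k * ε k = 1
  symm : ∀ y, (N y).IsSymm
  edge : ∀ y k l, N y (pos k) (pos l) = if k = l then y (g k) else 0
  vertex : ∀ y k, N y w (pos k) = ε k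
  vertex_zero : ∀ y i, (∀ k, i ≠ pos k) → N y w i = 0
  indep : ∀ y y' : E → F, (∀ e, (∀ k, e ≠ g k) → y e = y' e) →
    ∀ i j, (∀ k, ¬ (i = pos k ∧ j = pos k)) → N y i j = N y' i j

variable {E ι : Type*}

lemma exists_star_equiv (pos : Fin 3 → ι) (hpos : Function.Injective pos) (w : ι)
    (hw : ∀ k, pos k ≠ w) :
    ∃ f : Fin 2 ⊕ (Fin 2 ⊕ {i // i ≠ w ∧ ∀ k, i ≠ pos k}) ≃ ι,
      starPos f = pos ∧ f (.inl 1) = w ∧ ∀ i, f (.inr (.inr i)) = i.1 := by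
  have hb : Function.Bijective (Sum.elim ![pos 0, w] (Sum.elim ![pos 1, pos 2]
      (Subtype.val : {i // i ≠ w ∧ ∀ k, i ≠ pos k} → ι))) := by
    constructor
    · have h01 : pos 0 ≠ pos 1 := fun h => by simpa using hpos h
      have h02 : pos 0 ≠ pos 2 := fun h => by simpa using hpos h
      have h12 : pos 1 ≠ pos 2 := fun h => by simpa using hpos h
      rintro (i | i | ⟨i, hi, hi'⟩) (j | j | ⟨j, hj, hj'⟩) h
      · fin_cases i <;> fin_cases j <;> simp_all [(hw 0).symm]
      · fin_cases i <;> fin_cases j <;> simp_all [(hw 1).symm, (hw 2).symm]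
      · fin_cases i
        · exact absurd h.symm (hj' 0)
        · exact absurd h.symm hj
      · fin_cases i <;> fin_cases j <;> simp_all [h01.symm, h02.symm]
      · fin_cases i <;> fin_cases j <;> simp_all [h12.symm]
      · fin_cases i
        · exact absurd h.symm (hj' 1)
        · exact absurd h.symm (hj' 2)
      · fin_cases j
        · exact absurd h (hi' 0)
        · exact absurd h hi
      · fin_cases j
        · exact absurd h (hi' 1)
        · exact absurd h (hi' 2)
      · simpa using h
    · intro i
      by_cases hi : i = w
      · exact ⟨.inl 1, by simp [hi]⟩
      by_cases h0 : i = pos 0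
      · exact ⟨.inl 0, by simp [h0]⟩
      by_cases h1 : i = pos 1
      · exact ⟨.inr (.inl 0), by simp [h1]⟩
      by_cases h2 : i = pos 2
      · exact ⟨.inr (.inl 1), by simp [h2]⟩
      exact ⟨.inr (.inr ⟨i, hi, fun k => by fin_cases k <;> assumption⟩), rfl⟩
  refine ⟨Equiv.ofBijective _ hb, ?_, rfl, fun i => rfl⟩
  ext k
  fin_cases k <;> rfl

variable [Fintype ι] [DecidableEq ι]

/-- With all variables except the three at `w` fixed, the determinant is up to sign a bordered
determinant with generic symmetric corner, so each fibre count is divisible by `q ^ 2`. -/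
lemma IsTrivalent.sq_dvd_card_zeros [Finite F] [Finite E] {N : (E → F) → Matrix ι ι F} {g : Fin 3 → E}
    {pos : Fin 3 → ι} {w : ι} {ε : Fin 3 → F} (h : IsTrivalent N g pos w ε) :
    Nat.card F ^ 2 ∣ Nat.card {y // (N y).det = 0} := by
  classical
  obtain ⟨f, hf, hfw, hfi⟩ := exists_star_equiv pos h.injective_pos w h.pos_ne
  let k : Fin 3 ⊕ {e // e ∉ Set.range g} ≃ E :=
    (Equiv.sumCongr (Equiv.ofInjective g h.injective_var) (Equiv.refl _)).trans
      (Equiv.Set.sumCompl (Set.range g))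
  have hk : ∀ i, k.symm (g i) = .inl i := fun i => by
    rw [Equiv.symm_apply_eq]; rfl
  refine dvd_card_of_fibers k _ _ fun z => ?_
  set Y : (Fin 3 → F) → E → F := fun x => Sum.elim x z ∘ k.symm with hY
  have hYg : ∀ x i, Y x (g i) = x i := fun x i => by simp [Y, hk]
  have hYe : ∀ x x' e, (∀ i, e ≠ g i) → Y x e = Y x' e := by
    intro x x' e he
    obtain ⟨e', rfl⟩ := k.surjective e
    rcases e' with e' | e'
    · exact absurd rfl (he e')
    · simp [Y]
  -- The border and the block `Q` do not depend on the three variables at `w`, so they may be read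
  -- off at `x = 0`.
  set B := starBorder ε fun k i => N (Y 0) (starPos f k) (f (.inr (.inr i))) with hB
  set Q := (N (Y 0)).submatrix (fun i => f (.inr (.inr i))) fun i => f (.inr (.inr i)) with hQ
  have hdet : ∀ x, (N (Y x)).det = -(fromBlocks (corner (ε 1 * ε 2) x) B Bᵀ Q).det := by
    intro x
    rw [det_of_star (N (Y x)) (h.symm _) f x ε h.sign]
    · have e1 : ∀ i j, N (Y x) i (f (.inr (.inr j))) = N (Y 0) i (f (.inr (.inr j))) := by
        intro i j
        refine h.indep _ _ (hYe _ _) _ _ fun k hk => ?_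
        rw [hfi] at hk
        exact j.2.2 k hk.2
      simp only [e1, hB, hQ]
      congr 3
      ext i j
      simp [e1]
    · intro k l
      rw [hf, h.edge, hYg]
    · rw [hfw]
      exact h.vertex_zero _ _ fun k => (h.pos_ne k).symm
    · intro k
      rw [hf, hfw, h.vertex]
    · intro i
      rw [hfw, hfi]
      exact h.vertex_zero _ _ i.2.2
  have hη : ε 1 * ε 2 * (ε 1 * ε 2) = 1 := by
    linear_combination (ε 2 * ε 2) * h.sign 1 + h.sign 2
  have hQs : Q.IsSymm := (h.symm (Y 0)).submatrix _
  have hWs : (B * Q.adjugate * Bᵀ).IsSymm := by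
    rw [IsSymm, transpose_mul, transpose_mul, transpose_transpose, adjugate_transpose, hQs.eq,
      Matrix.mul_assoc]
  have hfin := sq_dvd_card_corner_zeros (ε 1 * ε 2) hη (B * Q.adjugate * Bᵀ)
    (hWs.apply 1 0) Q.det (fromBlocks 0 B Bᵀ Q).det (by
      have := det_fromBlocks_mul_det 0 B Bᵀ Q
      rw [mul_comm, this]
      simp [det_fin_two])
  convert hfin using 4 with x
  rw [hdet, neg_eq_zero, det_fromBlocks_eq_borderPoly]

lemma adjugate_diag_updateCol {R : Type*} [CommRing R] (M : Matrix ι ι R) (j : ι) (c : ι → R) :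
    (M.updateCol j c).adjugate j j = M.adjugate j j := by
  have h : ∀ M : Matrix ι ι R, ∀ c, (M.updateRow j c).adjugate j j = M.adjugate j j := by
    intro M c
    rw [adjugate_apply, adjugate_apply, updateRow_idem]
  have h2 := h Mᵀ c
  rwa [updateRow_transpose, ← adjugate_transpose (M.updateCol j c), ← adjugate_transpose M,
    transpose_apply, transpose_apply] at h2

lemma det_add_single {R : Type*} [CommRing R] (M : Matrix ι ι R) (j : ι) (t : R) :
    (M + Matrix.single j j t).det = M.det + t * M.adjugate j j := by
  have h : M + Matrix.single j j t = M.updateRow j (M j + t • Pi.single j 1) := by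
    ext a b
    by_cases ha : a = j
    · subst ha
      by_cases hb : b = a
      · subst hb; simp
      · simp [hb, Ne.symm hb]
    · simp [ha, Ne.symm ha]
  rw [h, det_updateRow_add, det_updateRow_smul, updateRow_eq_self, adjugate_apply]

/-- Adding `t` at the diagonal entry `j` gives the pencil `det N + t * adj N j j`, all of whose
members are still trivalent at `w`. Summed over `t`, the zero counts are `q` times the wanted number
plus the number of points where the minor is nonzero. The sum and the latter number are divisible by
`q ^ 2`, which leaves a factor `q`. -/
lemma IsTrivalent.card_dvd_card_common_zeros [Finite F] [Finite E] {N : (E → F) → Matrix ι ι F}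
    {g : Fin 3 → E} {pos : Fin 3 → ι} {w : ι} {ε : Fin 3 → F} (h : IsTrivalent N g pos w ε)
    (j : ι) (hjw : j ≠ w) (hj : ∀ k, j ≠ pos k) :
    Nat.card F ∣ Nat.card {y // (N y).det = 0 ∧ (N y).adjugate j j = 0} := by
  classical
  have := Fintype.ofFinite F
  have h1 : ∀ t, IsTrivalent (fun y => N y + Matrix.single j j t) g pos w ε := fun t =>
    { injective_var := h.injective_var
      injective_pos := h.injective_pos
      pos_ne := h.pos_ne
      sign := h.sign
      symm := fun y => (h.symm y).add (by simp [IsSymm])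
      edge := fun y k l => by
        rw [Matrix.add_apply, h.edge, Matrix.single_apply_of_ne, add_zero]
        exact fun hh => hj k hh.1
      vertex := fun y k => by
        rw [Matrix.add_apply, h.vertex, Matrix.single_apply_of_ne, add_zero]
        exact fun hh => hjw hh.1
      vertex_zero := fun y i hi => by
        rw [Matrix.add_apply, h.vertex_zero y i hi, Matrix.single_apply_of_ne, add_zero]
        exact fun hh => hjw hh.1
      indep := fun y y' hy a b hab => by
        rw [Matrix.add_apply, Matrix.add_apply, h.indep y y' hy a b hab] }
  -- Replacing row and column `j` by unit vectors yields a symmetric matrix, still trivalent at `w`,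
  -- whose determinant is the principal minor at `j`.
  have h2 : IsTrivalent (fun y => ((N y).updateCol j 0).updateRow j (Pi.single j 1)) g pos w ε :=
    { injective_var := h.injective_var
      injective_pos := h.injective_pos
      pos_ne := h.pos_ne
      sign := h.sign
      symm := fun y => by
        ext a b
        have := (h.symm y).apply a b
        by_cases ha : a = j <;> by_cases hb : b = j <;>
          simp [ha, hb, updateRow_apply, this]
      edge := fun y k l => by
        rw [updateRow_ne (hj k).symm, updateCol_ne (hj l).symm, h.edge]
      vertex := fun y k => by
        rw [updateRow_ne hjw.symm, updateCol_ne (hj k).symm, h.vertex]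
      vertex_zero := fun y i hi => by
        rw [updateRow_ne hjw.symm, updateCol_apply, h.vertex_zero y i hi]
        simp
      indep := fun y y' hy a b hab => by
        rw [updateRow_apply, updateRow_apply, updateCol_apply, updateCol_apply,
          h.indep y y' hy a b hab] }
  have e1 : Nat.card F ^ 2 ∣
      ∑ t : F, Nat.card {y // (N y).det + t * (N y).adjugate j j = 0} := by
    refine Finset.dvd_sum fun t _ => ?_
    have := (h1 t).sq_dvd_card_zeros
    simpa only [det_add_single] using this
  have e2 : Nat.card F ^ 2 ∣ Nat.card {y // (N y).adjugate j j = 0} := by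
    have := h2.sq_dvd_card_zeros
    simpa only [← adjugate_apply, adjugate_diag_updateCol] using this
  rw [sum_card_pencil (fun y => (N y).det) fun y => (N y).adjugate j j] at e1
  have e3 : Nat.card {y // (N y).adjugate j j = 0} + Nat.card {y // (N y).adjugate j j ≠ 0} =
      Nat.card (E → F) := by
    rw [← Nat.card_sum]
    exact Nat.card_congr (Equiv.sumCompl fun y => (N y).adjugate j j = 0)
  have e4 : Nat.card F ^ 2 ∣ Nat.card (E → F) := by
    rw [Nat.card_fun]
    refine pow_dvd_pow _ ?_
    have := Nat.card_le_card_of_injective g h.injective_var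
    simp at this
    omega
  have e5 : Nat.card F ^ 2 ∣ Nat.card {y // (N y).adjugate j j ≠ 0} :=
    (Nat.dvd_add_right e2).1 (e3 ▸ e4)
  have e6 := (Nat.dvd_add_left e5).1 e1
  rw [pow_two] at e6
  exact Nat.dvd_of_mul_dvd_mul_left Nat.card_pos e6

lemma card_dvd_card_common_zeros_of_bivalent {N : (E → F) → Matrix ι ι F}
    {e₁ e₂ : E} {i₁ i₂ w : ι} {ε₁ ε₂ : F} (he : e₁ ≠ e₂) (h12 : i₁ ≠ i₂)
    (h1w : i₁ ≠ w) (h2w : i₂ ≠ w) (hε₁ : ε₁ * ε₁ = 1) (hε₂ : ε₂ * ε₂ = 1)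
    (hN : ∀ y, (N y).IsSymm) (hw1 : ∀ y, N y w i₁ = ε₁) (hw2 : ∀ y, N y w i₂ = ε₂)
    (hw0 : ∀ y i, i ≠ i₁ → i ≠ i₂ → N y w i = 0)
    (h11 : ∀ y, N y i₁ i₁ = y e₁) (h22 : ∀ y, N y i₂ i₂ = y e₂)
    (h : ∀ y y' : E → F, (∀ e, e ≠ e₁ → e ≠ e₂ → y e = y' e) →
      ∀ i j, ¬ (i = i₁ ∧ j = i₁) → ¬ (i = i₂ ∧ j = i₂) → N y i j = N y' i j)
    (j : ι) (hjw : j ≠ w) (hj1 : j ≠ i₁) (hj2 : j ≠ i₂) :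
    Nat.card F ∣ Nat.card {y // (N y).det = 0 ∧ (N y).adjugate j j = 0} := by
  refine card_dvd_card_of_shift he _ fun y y' t hy1 hy2 hye => ?_
  -- The shift preserves `det N + c * adj N j j` for every `c`; `c = 0` and `c = 1` separate the
  -- determinant from the minor.
  have key : ∀ c, (N y' + Matrix.single j j c).det = (N y + Matrix.single j j c).det := by
    intro c
    refine det_eq_of_bivalent _ _ ((hN y).add (by simp [IsSymm])) h12 h1w h2w ε₁ ε₂ t hε₁ hε₂
      ?_ ?_ ?_ ?_ ?_ ?_
    · rw [Matrix.add_apply, hw1, Matrix.single_apply_of_ne, add_zero]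
      exact fun hh => hjw hh.1
    · rw [Matrix.add_apply, hw2, Matrix.single_apply_of_ne, add_zero]
      exact fun hh => hjw hh.1
    · intro i hi1 hi2
      rw [Matrix.add_apply, hw0 _ _ hi1 hi2, Matrix.single_apply_of_ne, add_zero]
      exact fun hh => hjw hh.1
    · rw [Matrix.add_apply, Matrix.add_apply, h11, h11, hy1, Matrix.single_apply_of_ne]
      · simp
      · exact fun hh => hj1 hh.1
    · rw [Matrix.add_apply, Matrix.add_apply, h22, h22, hy2, Matrix.single_apply_of_ne]
      · simp
      · exact fun hh => hj2 hh.1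
    · intro a b h1 h2
      rw [Matrix.add_apply, Matrix.add_apply, h y' y hye a b h1 h2]
  simp only [det_add_single] at key
  have k0 := key 0
  have k1 := key 1
  simp only [zero_mul, add_zero] at k0
  rw [k0, one_mul, one_mul, add_right_inj] at k1
  rw [k0, k1]
  exact id

end Field

/-! ### Degrees of determinants -/

section Degree

open MvPolynomial

/-- A bound for the degree of a determinant whose entries have degrees at most `a i + b j`. -/
lemma totalDegree_det_le {R σ ι : Type*} [CommRing R] [Fintype ι] [DecidableEq ι]
    (M : Matrix ι ι (MvPolynomial σ R)) (a b : ι → ℤ) (m : ℕ)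
    (h : ∀ i j, M i j = 0 ∨ ((M i j).totalDegree : ℤ) ≤ a i + b j)
    (hm : ∑ i, a i + ∑ i, b i ≤ m) : M.det.totalDegree ≤ m := by
  rw [det_apply]
  refine (totalDegree_finsetSum _ _).trans (Finset.sup_le fun π _ => ?_)
  have hs : (Equiv.Perm.sign π • ∏ i, M (π i) i).totalDegree ≤ (∏ i, M (π i) i).totalDegree := by
    rcases Int.units_eq_one_or (Equiv.Perm.sign π) with h | h <;> rw [h]
    · simp
    · simp
  refine hs.trans ?_
  by_cases hz : ∃ i, M (π i) i = 0
  · obtain ⟨i, hi⟩ := hz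
    rw [Finset.prod_eq_zero (f := fun i => M (π i) i) (Finset.mem_univ i) hi]
    simp
  · push Not at hz
    refine (totalDegree_finsetProd _ _).trans ?_
    have : (∑ i, ((M (π i) i).totalDegree : ℤ)) ≤ ∑ i, (a (π i) + b i) :=
      Finset.sum_le_sum fun i _ => (h _ _).resolve_left (hz i)
    rw [Finset.sum_add_distrib, Equiv.sum_comp π a] at this
    exact_mod_cast this.trans hm

end Degree

end C2Invariant

/-! ### The matrix tree theorem -/

namespace C2Invariant

open Matrix

section Expansion

variable {E ι : Type*} [DecidableEq E] {R : Type*} [CommRing R]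

/-- The symmetric matrix with the edge variables `y` on the diagonal, bordered by the incidence
matrix `B`. -/
def graphMatrix (B : Matrix E ι ℤ) (y : E → R) : Matrix (E ⊕ ι) (E ⊕ ι) R :=
  fromBlocks (diagonal y) (B.map (Int.cast : ℤ → R)) (B.map (Int.cast : ℤ → R))ᵀ 0

/-- The matrix whose determinant is the coefficient of `∏ e ∈ Tᶜ, y e` in the determinant of
`graphMatrix B y`. -/
def treeMatrix (B : Matrix E ι ℤ) (T : Finset E) : Matrix (E ⊕ ι) (E ⊕ ι) ℤ :=
  fromBlocks (diagonal fun e => if e ∈ T then 0 else 1) (of fun e v => if e ∈ T then B e v else 0)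
    Bᵀ 0

variable [Fintype E] [Fintype ι] [DecidableEq ι]

/-- Multilinear expansion in the rows, each split into its diagonal part and its border part. `Tᶜ`
is the set of rows in which the diagonal part is chosen; vertex rows have no diagonal part, so only
sets of edges occur. -/
lemma det_graphMatrix (B : Matrix E ι ℤ) (y : E → R) :
    (graphMatrix B y).det = ∑ T : Finset E, (∏ e ∈ Tᶜ, y e) * ((treeMatrix B T).det : R) := by
  set c : E ⊕ ι → R := Sum.elim y 0 with hc
  set m' : E ⊕ ι → E ⊕ ι → R := Sum.elim (fun e => Sum.elim 0 fun v => (B e v : R))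
    (fun v => Sum.elim (fun e => (B e v : R)) 0) with hm'
  have h0 : graphMatrix B y = (fun i => c i • (Pi.single i 1 : E ⊕ ι → R)) + m' := by
    ext (i | i) (j | j)
    · by_cases h : i = j
      · subst h; simp [graphMatrix, hc, hm']
      · simp [graphMatrix, hc, hm', h, Ne.symm h]
    · simp [graphMatrix, hc, hm']
    · simp [graphMatrix, hc, hm']
    · simp [graphMatrix, hc, hm']
  have h1 : ∀ s : Finset (E ⊕ ι),
      detRowAlternating.toMultilinearMap
        (s.piecewise (fun i => c i • (Pi.single i 1 : E ⊕ ι → R)) m') =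
      (∏ i ∈ s, c i) * detRowAlternating.toMultilinearMap
        (s.piecewise (fun i => (Pi.single i 1 : E ⊕ ι → R)) m') := by
    intro s
    rw [← smul_eq_mul, ← MultilinearMap.map_piecewise_smul]
    congr 1
    ext i j
    by_cases hi : i ∈ s <;> simp [hi]
  have h2 : (graphMatrix B y).det = ∑ s : Finset (E ⊕ ι), (∏ i ∈ s, c i) *
      detRowAlternating.toMultilinearMap
        (s.piecewise (fun i => (Pi.single i 1 : E ⊕ ι → R)) m') := by
    rw [h0]
    simp only [← h1]
    exact MultilinearMap.map_add_univ _ _ _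
  rw [h2]
  symm
  refine Finset.sum_of_injOn (fun T => (Tᶜ).disjSum ∅) ?_ (fun _ _ => Finset.mem_coe.2
    (Finset.mem_univ _)) ?_ ?_
  · intro S _ T _ h
    have h' : Sᶜ.disjSum (∅ : Finset ι) = Tᶜ.disjSum ∅ := h
    ext e
    have := congrArg (Sum.inl e ∈ ·) h'
    simpa [not_iff_not] using this
  · intro s _ hs
    obtain ⟨v, hv⟩ : ∃ v, Sum.inr v ∈ s := by
      by_contra! h
      refine hs ⟨(s.toLeft)ᶜ, by simp, ?_⟩
      ext (i | i)
      · simp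
      · simpa using h i
    rw [Finset.prod_eq_zero hv (by simp [hc]), zero_mul]
  · intro T _
    simp only [Finset.prod_disjSum, Finset.prod_empty, mul_one, hc, Sum.elim_inl]
    congr 1
    rw [Int.cast_det]
    change _ = det _
    congr 1
    ext (i | i) (j | j)
    · by_cases hi : i ∈ T
      · simp [treeMatrix, hm', hi, diagonal_apply]
      · by_cases h : i = j
        · subst h; simp [treeMatrix, hi]
        · simp [treeMatrix, hi, h, Ne.symm h]
    · by_cases hi : i ∈ T <;> simp [treeMatrix, hm', hi]
    · simp [treeMatrix, hm']
    · simp [treeMatrix, hm']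

/-- The determinant of the matrix exchanging two copies of `ι`. -/
def swapSign (ι : Type*) [Fintype ι] [DecidableEq ι] : ℤ :=
  (fromBlocks 0 1 1 0 : Matrix (ι ⊕ ι) (ι ⊕ ι) ℤ).det

lemma swapSign_mul_self : swapSign ι * swapSign ι = 1 := by
  rw [swapSign, ← det_mul, fromBlocks_multiply]
  simp

/-- The functions `f` dual to the edges of `T` invert the square incidence block `C` of `T` over
`ℤ`, so `det C = ±1`. Both `C` and `Cᵀ` occur in the determinant, so the sign of `det C` cancels and
the value is the same for all `T`. -/
lemma det_treeMatrix_of_equiv (B : Matrix E ι ℤ) (T : Finset E) (τ : {e // e ∈ T} ≃ ι)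
    (h : ∀ e ∈ T, ∃ f : ι → ℤ, ∀ e' ∈ T, ∑ v, B e' v * f v = if e' = e then 1 else 0) :
    (treeMatrix B T).det = swapSign ι := by
  set C : Matrix ι ι ℤ := of fun i v => B (τ.symm i) v with hC
  have hCdet : C.det * C.det = 1 := by
    choose! f hf using h
    have h1 : C * (of fun v i => f (τ.symm i) v) = 1 := by
      ext i j
      rw [Matrix.mul_apply, Matrix.one_apply]
      simp only [hC, of_apply]
      rw [hf _ (τ.symm j).2 _ (τ.symm i).2]
      simp [Subtype.ext_iff.symm]
    have h2 : IsUnit C.det := IsUnit.of_mul_eq_one _ (by rw [← det_mul, h1, det_one])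
    rcases Int.isUnit_iff.1 h2 with h | h <;> rw [h] <;> norm_num
  have hb : Function.Bijective (Sum.elim (fun e : {e // e ∉ T} => Sum.inl e.1)
      (Sum.elim (fun i => Sum.inl (τ.symm i).1) Sum.inr) : {e // e ∉ T} ⊕ (ι ⊕ ι) → E ⊕ ι) := by
    constructor
    · rintro (⟨i, hi⟩ | i | i) (⟨j, hj⟩ | j | j) h <;> simp at h
      · simpa using h
      · exact absurd (h ▸ (τ.symm j).2) hi
      · exact absurd (h ▸ (τ.symm i).2) hj
      · simpa [Subtype.ext_iff.symm] using h
      · simpa using h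
    · rintro (e | v)
      · by_cases he : e ∈ T
        · exact ⟨.inr (.inl (τ ⟨e, he⟩)), by simp⟩
        · exact ⟨.inl ⟨e, he⟩, rfl⟩
      · exact ⟨.inr (.inr v), rfl⟩
  rw [← det_submatrix_equiv_self (Equiv.ofBijective _ hb)]
  have hmat : (treeMatrix B T).submatrix (Equiv.ofBijective _ hb) (Equiv.ofBijective _ hb) =
      fromBlocks 1 0 (of (Sum.elim 0 fun v e => B e.1 v)) (fromBlocks 0 C Cᵀ 0) := by
    ext (⟨i, hi⟩ | i | i) (⟨j, hj⟩ | j | j)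
    · by_cases h : i = j
      · subst h; simp [treeMatrix, hi]
      · simp [treeMatrix, h]
    · have : i ≠ (τ.symm j).1 := fun h => hi (h ▸ (τ.symm j).2)
      simp [treeMatrix, this]
    · simp [treeMatrix, hi]
    · have : (τ.symm i).1 ≠ j := fun h => hj (h ▸ (τ.symm i).2)
      simp [treeMatrix, this]
    · simp [treeMatrix, diagonal_apply]
    · simp [treeMatrix, hC]
    · simp [treeMatrix]
    · simp [treeMatrix, hC]
    · simp [treeMatrix]
  rw [hmat, det_fromBlocks_zero₁₂, det_one, one_mul]
  have hprod : fromBlocks 0 C Cᵀ 0 = fromBlocks C 0 0 Cᵀ * fromBlocks 0 1 1 0 := by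
    rw [fromBlocks_multiply]
    simp
  rw [hprod, det_mul, det_fromBlocks_zero₁₂, det_transpose, hCdet, one_mul, swapSign]

lemma det_treeMatrix_of_kernel (B : Matrix E ι ℤ) (T : Finset E) (f : ι → ℤ) (hf : f ≠ 0)
    (h : ∀ e ∈ T, ∑ v, B e v * f v = 0) : (treeMatrix B T).det = 0 := by
  rw [← exists_mulVec_eq_zero_iff]
  refine ⟨Sum.elim 0 f, fun h0 => hf ?_, ?_⟩
  · ext v; exact congrFun h0 (.inr v)
  · rw [treeMatrix, fromBlocks_mulVec]
    ext (e | v)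
    · by_cases he : e ∈ T
      · simpa [mulVec, dotProduct, he] using h e he
      · simp [mulVec, dotProduct, he]
    · simp

/-- More rows than columns: a linear relation among the incidence rows of `T` gives a vector in the
left kernel. -/
lemma det_treeMatrix_of_card_lt (B : Matrix E ι ℤ) (T : Finset E)
    (h : Fintype.card ι < T.card) : (treeMatrix B T).det = 0 := by
  let φ : ({e // e ∈ T} → ℤ) →ₗ[ℤ] (ι → ℤ) :=
    (of fun v (e : {e // e ∈ T}) => B e.1 v : Matrix ι {e // e ∈ T} ℤ).mulVecLin
  have hφ : ¬ Function.Injective φ := fun hi => by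
    have := card_le_of_injective ℤ φ hi
    rw [Fintype.card_coe] at this
    omega
  rw [← LinearMap.ker_eq_bot] at hφ
  obtain ⟨z, hz, hz0⟩ := (Submodule.ne_bot_iff _).1 hφ
  rw [← exists_vecMul_eq_zero_iff]
  refine ⟨Sum.elim (fun e => if he : e ∈ T then z ⟨e, he⟩ else 0) 0, fun h0 => hz0 ?_, ?_⟩
  · ext e
    simpa using congrFun h0 (.inl e.1)
  · rw [treeMatrix, vecMul_fromBlocks]
    ext (e | v)
    · by_cases he : e ∈ T
      · simp [vecMul_diagonal, he]
      · simp [vecMul_diagonal, he]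
    · have hv := congrFun (LinearMap.mem_ker.1 hz) v
      simp only [φ, mulVecLin_apply, mulVec, dotProduct, of_apply, Pi.zero_apply] at hv
      simp only [Sum.elim_comp_inl, Sum.elim_comp_inr, zero_vecMul, add_zero, Sum.elim_inr,
        Pi.zero_apply, vecMul, dotProduct, of_apply]
      refine Eq.trans (Eq.symm (Finset.sum_of_injOn Subtype.val Subtype.val_injective.injOn
        (by simp) ?_ ?_)) hv
      · intro e _ he
        have : e ∉ T := fun h => he ⟨⟨e, h⟩, by simp, rfl⟩
        simp [this]
      · rintro ⟨e, he⟩ _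
        simp [he, mul_comm]

end Expansion

/-! ### Incidence matrices and spanning trees -/

section Graph

variable {V : Type u} {G : SimpleGraph V}

/-- The oriented incidence matrix of a graph with the column of the vertex `r` removed. -/
def incidence [DecidableEq V] (o : G.edgeSet → V × V) (r : V) : Matrix G.edgeSet {x // x ≠ r} ℤ :=
  of fun e x => (if (o e).1 = x then 1 else 0) - (if (o e).2 = x then 1 else 0)

/-- The spanning subgraph with edge set `T`. -/
def spanningGraph (T : Finset G.edgeSet) : SimpleGraph V :=
  SimpleGraph.fromEdgeSet {e : Sym2 V | ∃ h : e ∈ G.edgeSet, (⟨e, h⟩ : G.edgeSet) ∈ T}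

lemma isSpanningTree_iff (T : Finset G.edgeSet) :
    IsSpanningTree G T ↔ (spanningGraph T).IsTree := Iff.rfl

lemma edgeSet_spanningGraph (T : Finset G.edgeSet) :
    (spanningGraph T).edgeSet = Subtype.val '' (T : Set G.edgeSet) := by
  rw [spanningGraph, SimpleGraph.edgeSet_fromEdgeSet]
  ext e
  constructor
  · rintro ⟨⟨h, hT⟩, -⟩
    exact ⟨⟨e, h⟩, hT, rfl⟩
  · rintro ⟨⟨e, he⟩, hT, rfl⟩
    exact ⟨⟨he, hT⟩, G.not_isDiag_of_mem_edgeSet he⟩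

lemma card_edgeSet_spanningGraph (T : Finset G.edgeSet) :
    Nat.card (spanningGraph T).edgeSet = T.card := by
  rw [edgeSet_spanningGraph, Nat.card_image_of_injective Subtype.val_injective]
  simp

lemma spanningGraph_adj {o : G.edgeSet → V × V} (ho : ∀ e, s((o e).1, (o e).2) = e.1)
    {T : Finset G.edgeSet} {e : G.edgeSet} (he : e ∈ T) :
    (spanningGraph T).Adj (o e).1 (o e).2 := by
  rw [← SimpleGraph.mem_edgeSet, ho, edgeSet_spanningGraph]
  exact ⟨e, he, rfl⟩

variable [Fintype V] [DecidableEq V]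

lemma sum_incidence_mul (o : G.edgeSet → V × V) (r : V) (e : G.edgeSet) (f : V → ℤ)
    (hf : f r = 0) :
    ∑ x : {x // x ≠ r}, incidence o r e x * f x = f (o e).1 - f (o e).2 := by
  have h : ∑ x : {x // x ≠ r}, incidence o r e x * f x =
      ∑ x, ((if (o e).1 = x then 1 else 0) - (if (o e).2 = x then 1 else 0)) * f x := by
    refine Finset.sum_of_injOn Subtype.val Subtype.val_injective.injOn (by simp) ?_ fun _ _ => rfl
    intro x _ hx
    have : x = r := by
      by_contra h
      exact hx ⟨⟨x, h⟩, by simp, rfl⟩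
    simp [this, hf]
  rw [h]
  simp [sub_mul]

variable [Fintype G.edgeSet]

/-- For a tree every edge is a bridge, and the indicator of one side of it, normalised to vanish at
`r`, is the function dual to that edge. If `T` is disconnected, the indicator of the vertices not
reachable from `r` lies in the kernel. If `T` is connected but not a tree, it has too many edges. -/
lemma det_treeMatrix_incidence [DecidableEq G.edgeSet] (o : G.edgeSet → V × V) (ho : ∀ e, s((o e).1, (o e).2) = e.1)
    (r : V) (T : Finset G.edgeSet) [Decidable (IsSpanningTree G T)] :
    (treeMatrix (incidence o r) T).det =
      if IsSpanningTree G T then swapSign {x // x ≠ r} else 0 := by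
  have hcardV : Nat.card V = Fintype.card {x // x ≠ r} + 1 := by
    rw [Fintype.card_subtype_compl, Nat.card_eq_fintype_card, Fintype.card_subtype_eq]
    have : 0 < Fintype.card V := Fintype.card_pos_iff.2 ⟨r⟩
    omega
  split_ifs with hT
  · rw [isSpanningTree_iff] at hT
    have hcard := (SimpleGraph.isTree_iff_connected_and_card.1 hT).2
    rw [card_edgeSet_spanningGraph, hcardV, Nat.add_right_cancel_iff] at hcard
    refine det_treeMatrix_of_equiv _ T (Fintype.equivOfCardEq (by rw [Fintype.card_coe, hcard])) ?_
    intro e he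
    have hbr := SimpleGraph.isAcyclic_iff_forall_adj_isBridge.1 hT.isAcyclic
      (spanningGraph_adj ho he)
    rw [SimpleGraph.isBridge_iff] at hbr
    set H := (spanningGraph T).deleteEdges {s((o e).1, (o e).2)} with hH
    classical
    let g : V → ℤ := fun x => if H.Reachable (o e).1 x then 1 else 0
    refine ⟨fun x => g x - g r, fun e' he' => ?_⟩
    rw [sum_incidence_mul o r e' (fun x => g x - g r) (sub_self _)]
    split_ifs with hee
    · subst hee
      simp [g, hbr]
    · have hadj : H.Adj (o e').1 (o e').2 := by
        rw [hH, SimpleGraph.deleteEdges_adj]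
        refine ⟨spanningGraph_adj ho he', ?_⟩
        rw [ho, ho]
        simpa [Subtype.ext_iff] using hee
      have : H.Reachable (o e).1 (o e').1 ↔ H.Reachable (o e).1 (o e').2 :=
        ⟨fun h => h.trans hadj.reachable, fun h => h.trans hadj.symm.reachable⟩
      simp [g, this]
  · rw [isSpanningTree_iff] at hT
    by_cases hc : (spanningGraph T).Connected
    · apply det_treeMatrix_of_card_lt
      have h1 := hc.card_vert_le_card_edgeSet_add_one
      have h2 : ¬ (Nat.card (spanningGraph T).edgeSet + 1 = Nat.card V) := fun h =>
        hT (SimpleGraph.isTree_iff_connected_and_card.2 ⟨hc, h⟩)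
      rw [card_edgeSet_spanningGraph, hcardV] at h1 h2
      omega
    · obtain ⟨x, hx⟩ : ∃ x, ¬ (spanningGraph T).Reachable r x := by
        by_contra! h
        have : Nonempty V := ⟨r⟩
        exact hc ⟨fun a b => (h a).symm.trans (h b)⟩
      classical
      let f : V → ℤ := fun x => if (spanningGraph T).Reachable r x then 0 else 1
      have hxr : x ≠ r := fun h => hx (h ▸ SimpleGraph.Reachable.refl _)
      refine det_treeMatrix_of_kernel _ T (fun x => f x) (fun h0 => ?_) fun e he => ?_
      · simpa [f, hx] using congrFun h0 ⟨x, hxr⟩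
      · rw [sum_incidence_mul o r e f (by simp [f])]
        have hadj := spanningGraph_adj ho he
        have : (spanningGraph T).Reachable r (o e).1 ↔ (spanningGraph T).Reachable r (o e).2 :=
          ⟨fun h => h.trans hadj.reachable, fun h => h.trans hadj.symm.reachable⟩
        simp [f, this]

open Classical in
/-- The matrix tree theorem. -/
lemma det_graphMatrix_incidence {R : Type*} [CommRing R] (o : G.edgeSet → V × V)
    (ho : ∀ e, s((o e).1, (o e).2) = e.1) (r : V) (y : G.edgeSet → R) :
    (graphMatrix (incidence o r) y).det =
      (swapSign {x // x ≠ r} : R) * MvPolynomial.aeval y (kirchhoffPoly G) := by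
  rw [det_graphMatrix, kirchhoffPoly, map_sum, Finset.mul_sum, Finset.sum_filter]
  refine Finset.sum_congr (by congr; exact Subsingleton.elim _ _) fun T _ => ?_
  rw [det_treeMatrix_incidence o ho]
  split_ifs
  · rw [map_prod]
    simp only [MvPolynomial.aeval_X]
    rw [mul_comm]
    congr <;> exact Subsingleton.elim _ _
  · simp

end Graph

end C2Invariant

/-! ### Determinants of graph matrices -/

namespace C2Invariant

open Matrix

section GraphMatrix

variable {E ι : Type*} [DecidableEq E]

lemma graphMatrix_isSymm {R : Type*} [CommRing R] (B : Matrix E ι ℤ) (y : E → R) :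
    (graphMatrix B y).IsSymm := by
  rw [IsSymm, graphMatrix, fromBlocks_transpose]
  simp

lemma map_graphMatrix {R S : Type*} [CommRing R] [CommRing S] (φ : R →+* S) (B : Matrix E ι ℤ)
    (y : E → R) : (graphMatrix B y).map φ = graphMatrix B fun e => φ (y e) := by
  ext (i | i) (j | j)
  · by_cases h : i = j
    · subst h; simp [graphMatrix]
    · simp [graphMatrix, h]
  · simp [graphMatrix]
  · simp [graphMatrix]
  · simp [graphMatrix]

open MvPolynomial in
-- Weight 1 on edge rows and -1 on vertex columns bounds every nonzero entry, the border entries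
-- having degree 0. The total weight is the number of edges minus the number of vertex columns.
lemma graphMatrix_entry_degree {k : Type*} [CommRing k] [Nontrivial k] (B : Matrix E ι ℤ)
    (i j : E ⊕ ι) :
    graphMatrix B (X : E → MvPolynomial E k) i j = 0 ∨
      ((graphMatrix B (X : E → MvPolynomial E k) i j).totalDegree : ℤ) ≤
        Sum.elim (fun _ => 1) (fun _ => 0) i + Sum.elim (fun _ => 0) (fun _ => -1) j := by
  have hc : ∀ z : ℤ, (z : MvPolynomial E k).totalDegree = 0 := fun z => by
    rw [← map_intCast (C : k →+* MvPolynomial E k), totalDegree_C]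
  rcases i with i | i <;> rcases j with j | j
  · by_cases h : i = j
    · subst h; simp [graphMatrix]
    · simp [graphMatrix, h]
  · simp [graphMatrix, hc]
  · simp [graphMatrix, hc]
  · simp [graphMatrix]

variable [Fintype E] [Fintype ι] [DecidableEq ι]

lemma aeval_det_graphMatrix {k F : Type*} [CommRing k] [CommRing F] [Algebra k F]
    (B : Matrix E ι ℤ) (y : E → F) :
    MvPolynomial.aeval y (graphMatrix B (MvPolynomial.X : E → MvPolynomial E k)).det =
      (graphMatrix B y).det := by
  have h := RingHom.map_det (MvPolynomial.aeval (R := k) y).toRingHom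
    (graphMatrix B (MvPolynomial.X : E → MvPolynomial E k))
  rw [RingHom.mapMatrix_apply, map_graphMatrix] at h
  simpa using h

lemma aeval_adjugate_graphMatrix {k F : Type*} [CommRing k] [CommRing F] [Algebra k F]
    (B : Matrix E ι ℤ) (y : E → F) (i j : E ⊕ ι) :
    MvPolynomial.aeval y ((graphMatrix B (MvPolynomial.X : E → MvPolynomial E k)).adjugate i j) =
      (graphMatrix B y).adjugate i j := by
  have h := RingHom.map_adjugate (MvPolynomial.aeval (R := k) y).toRingHom
    (graphMatrix B (MvPolynomial.X : E → MvPolynomial E k))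
  rw [RingHom.mapMatrix_apply, RingHom.mapMatrix_apply, map_graphMatrix] at h
  simpa using congrFun (congrFun h i) j

lemma totalDegree_det_graphMatrix_le {k : Type*} [CommRing k] [Nontrivial k] (B : Matrix E ι ℤ)
    (m : ℕ) (hm : Fintype.card E ≤ m + Fintype.card ι) :
    (graphMatrix B (MvPolynomial.X : E → MvPolynomial E k)).det.totalDegree ≤ m := by
  refine totalDegree_det_le _ _ _ m (graphMatrix_entry_degree B) ?_
  simp
  omega

open MvPolynomial in
lemma totalDegree_adjugate_graphMatrix_le {k : Type*} [CommRing k] [Nontrivial k]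
    (B : Matrix E ι ℤ) (a b : ι) (m : ℕ) (hm : Fintype.card E + 1 ≤ m + Fintype.card ι) :
    ((graphMatrix B (X : E → MvPolynomial E k)).adjugate (.inr a) (.inr b)).totalDegree ≤ m := by
  rw [adjugate_apply]
  -- Row `b` becomes a unit vector whose entry 1 stands in a vertex column of weight -1, so this row
  -- needs weight 1; that is the extra 1 in the degree bound.
  refine totalDegree_det_le _ (Sum.elim (fun _ => 1) (fun i => if i = b then 1 else 0))
    (Sum.elim (fun _ => 0) (fun _ => -1)) m (fun i j => ?_) ?_
  · by_cases hi : i = .inr b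
    · subst hi
      rw [updateRow_self]
      by_cases hj : j = .inr a
      · subst hj; simp
      · simp [hj]
    · rw [updateRow_ne hi]
      refine (graphMatrix_entry_degree B i j).imp id fun h => h.trans ?_
      rcases i with i | i
      · simp
      · have : i ≠ b := fun h => hi (h ▸ rfl)
        simp [this]
  · simp
    omega

/-- A vertex of degree two or three forces the divisibility of the number of common zeros of the
determinant and of its principal minor at another vertex. -/
lemma card_dvd_card_common_zeros_graphMatrix {F : Type*} [Field F] [Finite F] (B : Matrix E ι ℤ)
    (v v' : ι) (hv : v' ≠ v) (hsign : ∀ e, B e v ≠ 0 → B e v * B e v = 1)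
    (hcard : (Finset.univ.filter fun e => B e v ≠ 0).card = 2 ∨
      (Finset.univ.filter fun e => B e v ≠ 0).card = 3) :
    Nat.card F ∣ Nat.card {y : E → F // (graphMatrix B y).det = 0 ∧
      (graphMatrix B y).adjugate (.inr v') (.inr v') = 0} := by
  have hsignF : ∀ e, B e v ≠ 0 → (B e v : F) * (B e v : F) = 1 := fun e he => by
    rw [← Int.cast_mul, hsign e he, Int.cast_one]
  rcases hcard with hcard | hcard
  · obtain ⟨e₁, e₂, h12, hs⟩ := Finset.card_eq_two.1 hcard
    have hmem : ∀ e, B e v ≠ 0 ↔ e = e₁ ∨ e = e₂ := fun e => by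
      simpa using Finset.ext_iff.1 hs e
    refine card_dvd_card_common_zeros_of_bivalent (N := fun y => graphMatrix B y) (e₁ := e₁)
      (e₂ := e₂) (i₁ := .inl e₁) (i₂ := .inl e₂) (w := .inr v)
      (ε₁ := (B e₁ v : F)) (ε₂ := (B e₂ v : F)) h12 (by simpa using h12) (by simp) (by simp) (hsignF _ ((hmem _).2 (.inl rfl)))
      (hsignF _ ((hmem _).2 (.inr rfl))) (graphMatrix_isSymm B) ?_ ?_ ?_ ?_ ?_ ?_ (.inr v')
      (by simpa using hv) (by simp) (by simp)
    · intro y; simp [graphMatrix]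
    · intro y; simp [graphMatrix]
    · rintro y (e | x) h1 h2
      · have : B e v = 0 := by
          by_contra h
          rcases (hmem e).1 h with rfl | rfl
          · exact h1 rfl
          · exact h2 rfl
        simp [graphMatrix, this]
      · simp [graphMatrix]
    · intro y; simp [graphMatrix]
    · intro y; simp [graphMatrix]
    · rintro y y' hy (i | i) (j | j) h1 h2
      · by_cases hij : i = j
        · subst hij
          simp only [graphMatrix, fromBlocks_apply₁₁, diagonal_apply_eq]
          exact hy _ (fun h => h1 (by simp [h])) fun h => h2 (by simp [h])
        · simp [graphMatrix, hij]
      · simp [graphMatrix]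
      · simp [graphMatrix]
      · simp [graphMatrix]
  · let τ : Fin 3 ≃ {e // e ∈ Finset.univ.filter fun e => B e v ≠ 0} :=
      (finCongr hcard.symm).trans (Finset.equivFin _).symm
    have hτ : ∀ k, B (τ k).1 v ≠ 0 := fun k => (Finset.mem_filter.1 (τ k).2).2
    have hτs : ∀ e, (∀ k, e ≠ (τ k).1) → B e v = 0 := by
      intro e he
      by_contra h
      exact he (τ.symm ⟨e, by simpa using h⟩) (by simp)
    have hinj : Function.Injective fun k => (τ k).1 := Subtype.val_injective.comp τ.injective
    have key : IsTrivalent (fun y : E → F => graphMatrix B y) (fun k => (τ k).1)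
        (fun k => .inl (τ k).1) (.inr v) (fun k => (B (τ k).1 v : F)) :=
      { injective_var := hinj
        injective_pos := Sum.inl_injective.comp hinj
        pos_ne := fun k => by simp
        sign := fun k => hsignF _ (hτ k)
        symm := graphMatrix_isSymm B
        edge := fun y k l => by
          by_cases h : k = l
          · subst h; simp [graphMatrix]
          · have : (τ k).1 ≠ (τ l).1 := fun h' => h (hinj h')
            simp [graphMatrix, h, this]
        vertex := fun y k => by simp [graphMatrix]
        vertex_zero := by
          rintro y (e | x) h
          · have := hτs e fun k hk => h k (by rw [hk])
            simp [graphMatrix, this]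
          · simp [graphMatrix]
        indep := by
          rintro y y' hy (i | i) (j | j) h
          · by_cases hij : i = j
            · subst hij
              simp only [graphMatrix, fromBlocks_apply₁₁, diagonal_apply_eq]
              exact hy _ fun k hk => h k (by simp [hk])
            · simp [graphMatrix, hij]
          · simp [graphMatrix]
          · simp [graphMatrix]
          · simp [graphMatrix] }
    exact key.card_dvd_card_common_zeros (.inr v') (by simpa using hv) fun k => by simp

end GraphMatrix

/-- The total number of zeros of a family of bordered determinants. -/
lemma sum_card_corner_zeros {F Z : Type*} [Field F] [Finite F] [Fintype Z] (η : F)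
    (hη : η * η = 1) (d κ : Z → F) (W : Z → Matrix (Fin 2) (Fin 2) F)
    (hW : ∀ z, W z 0 1 = W z 1 0) (hκ : ∀ z, d z * κ z = (W z).det)
    (hZ : Nat.card F ∣ Nat.card Z)
    (h0 : Nat.card F ∣ Nat.card {z // d z = 0 ∧ W z 0 0 = 0})
    (h1 : Nat.card F ∣ Nat.card {z // d z = 0 ∧ W z 1 1 = 0}) :
    ∃ m, ∑ z, Nat.card {x : Fin 3 → F // borderPoly (corner η x) (W z) (d z) (κ z) = 0} =
        Nat.card F ^ 2 * m ∧
      m ≡ Nat.card {z // d z = 0 ∧ W z 0 1 = 0} [MOD Nat.card F] := by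
  classical
  set q := Nat.card F with hq
  -- At the bad points the fibre count is a multiple of `q ^ 3`; everywhere else it is exactly `q ^
  -- 2`.
  set bad : Z → Prop := fun z => d z = 0 ∧ W z 0 0 = 0 ∧ W z 1 1 = 0 with hbad
  have hc : ∀ z, ∃ c, Nat.card {x : Fin 3 → F // borderPoly (corner η x) (W z) (d z) (κ z) = 0} =
      q ^ 2 * ((if bad z then 0 else 1) + q * c) := by
    intro z
    by_cases hz : bad z
    · obtain ⟨c, hc⟩ := card_corner_zeros_of_eq η (W z) (hW z) (d z) (κ z) (hκ z) hz
      exact ⟨c, by rw [hc, if_pos hz]; ring⟩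
    · refine ⟨0, ?_⟩
      rw [card_corner_zeros_of_ne η hη (W z) (hW z) (d z) (κ z) (hκ z) hz, if_neg hz]
      ring
  choose c hc using hc
  refine ⟨∑ z, ((if bad z then 0 else 1) + q * c z), ?_, ?_⟩
  · rw [Finset.mul_sum]
    exact Finset.sum_congr rfl fun z _ => hc z
  have e1 : ∑ z, ((if bad z then 0 else 1) + q * c z) + Nat.card {z // bad z} =
      Nat.card Z + q * ∑ z, c z := by
    rw [Finset.sum_add_distrib, ← Finset.mul_sum, Nat.card_eq_fintype_card (α := {z // bad z}),
      Fintype.card_subtype, Finset.card_filter, add_right_comm, ← Finset.sum_add_distrib]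
    congr 1
    rw [Nat.card_eq_fintype_card, ← Finset.card_univ, Finset.card_eq_sum_ones]
    refine Finset.sum_congr rfl fun z _ => ?_
    split_ifs <;> rfl
  -- Inclusion–exclusion: where `d = 0`, the vanishing of `det W` makes `W 0 1 = 0` equivalent to `W
  -- 0 0 = 0` or `W 1 1 = 0`.
  have e2 : Nat.card {z // d z = 0 ∧ W z 0 1 = 0} + Nat.card {z // bad z} =
      Nat.card {z // d z = 0 ∧ W z 0 0 = 0} + Nat.card {z // d z = 0 ∧ W z 1 1 = 0} := by
    have hdet : ∀ z, d z = 0 → (W z 0 1 = 0 ↔ W z 0 0 = 0 ∨ W z 1 1 = 0) := by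
      intro z hz
      have := hκ z
      rw [hz, zero_mul, det_fin_two, ← hW] at this
      rw [← mul_eq_zero, ← mul_self_eq_zero (a := W z 0 1)]
      rw [show W z 0 0 * W z 1 1 = W z 0 1 * W z 0 1 by linear_combination -this]
    simp only [Nat.card_eq_fintype_card, Fintype.card_subtype]
    rw [← Finset.card_union_add_card_inter (Finset.univ.filter fun z => d z = 0 ∧ W z 0 0 = 0), ← Finset.filter_or, ← Finset.filter_and]
    congr 2
    · ext z
      simp only [Finset.mem_filter, Finset.mem_univ, true_and]
      have := hdet z
      tauto
    · ext z
      simp only [Finset.mem_filter, Finset.mem_univ, true_and, hbad]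
      tauto
  have e3 : ∑ z, ((if bad z then 0 else 1) + q * c z) + Nat.card {z // bad z} ≡
      Nat.card {z // d z = 0 ∧ W z 0 1 = 0} + Nat.card {z // bad z} [MOD q] := by
    rw [e1, e2]
    exact ((Nat.modEq_zero_iff_dvd.2 (hZ.add (dvd_mul_right _ _))).trans
      (Nat.modEq_zero_iff_dvd.2 (h0.add h1)).symm)
  exact Nat.ModEq.add_right_cancel' _ e3

end C2Invariant

/-! ### Deleting a trivalent vertex -/

namespace C2Invariant

open Matrix

section Trivalent

variable {V : Type u} {G : SimpleGraph V}

/-- The incidence matrix of `G` with the vertex `w` and its edges as well as the column of `r`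
removed. -/
def deletedIncidence [DecidableEq V] (o : G.edgeSet → V × V) (r w : V) :
    Matrix {e : G.edgeSet // w ∉ e.1} {x // x ≠ r ∧ x ≠ w} ℤ :=
  of fun e x => (if (o e.1).1 = x then 1 else 0) - (if (o e.1).2 = x then 1 else 0)

/-- The `k`-th edge at a vertex `w` whose neighbours are the vertices `a k`. -/
def starEdge {w : V} {a : Fin 3 → V} (hadj : ∀ k, G.Adj w (a k)) (k : Fin 3) : G.edgeSet :=
  ⟨s(w, a k), hadj k⟩

lemma starEdge_injective {w : V} {a : Fin 3 → V} (hadj : ∀ k, G.Adj w (a k))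
    (ha : Function.Injective a) : Function.Injective (starEdge hadj) := by
  intro k l h
  have h1 : s(w, a k) = s(w, a l) := congrArg Subtype.val h
  exact ha (Sym2.congr_right.1 h1)

lemma exists_starEdge_eq {w : V} {a : Fin 3 → V} (hadj : ∀ k, G.Adj w (a k))
    (hnbr : ∀ x, G.Adj w x → ∃ k, x = a k) (e : G.edgeSet) (he : w ∈ e.1) :
    ∃ k, e = starEdge hadj k := by
  obtain ⟨x, hx⟩ := he
  have hwx : G.Adj w x := by rw [← SimpleGraph.mem_edgeSet, ← hx]; exact e.2
  obtain ⟨k, rfl⟩ := hnbr x hwx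
  exact ⟨k, Subtype.ext hx⟩

lemma mem_starEdge {w : V} {a : Fin 3 → V} (hadj : ∀ k, G.Adj w (a k)) (k : Fin 3) :
    w ∈ (starEdge hadj k).1 := Sym2.mem_mk_left _ _

variable [DecidableEq V]

/-- The edges of `G` are the three edges at `w` and the edges avoiding `w`. -/
lemma exists_edge_equiv {w : V} {a : Fin 3 → V} (hadj : ∀ k, G.Adj w (a k))
    (ha : Function.Injective a) (hnbr : ∀ x, G.Adj w x → ∃ k, x = a k) :
    ∃ f : Fin 3 ⊕ {e : G.edgeSet // w ∉ e.1} ≃ G.edgeSet,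
      (∀ k, f (.inl k) = starEdge hadj k) ∧ ∀ e, f (.inr e) = e.1 := by
  have hb : Function.Bijective (Sum.elim (starEdge hadj)
      (Subtype.val : {e : G.edgeSet // w ∉ e.1} → G.edgeSet)) := by
    constructor
    · rintro (k | ⟨e, he⟩) (l | ⟨e', he'⟩) h
      · exact congrArg _ (starEdge_injective hadj ha h)
      · have h' : starEdge hadj k = e' := h
        exact absurd (h' ▸ mem_starEdge hadj k) he'
      · have h' : e = starEdge hadj l := h
        exact absurd (h' ▸ mem_starEdge hadj l) he
      · simpa using h
    · intro e
      by_cases he : w ∈ e.1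
      · obtain ⟨k, rfl⟩ := exists_starEdge_eq hadj hnbr e he
        exact ⟨.inl k, rfl⟩
      · exact ⟨.inr ⟨e, he⟩, rfl⟩
  exact ⟨Equiv.ofBijective _ hb, fun _ => rfl, fun _ => rfl⟩

/-- The index of a trivalent vertex and of its three edges, moved to the front. -/
def starShuffle (α β : Type*) : Fin 2 ⊕ (Fin 2 ⊕ (α ⊕ β)) ≃ (Fin 3 ⊕ α) ⊕ (Unit ⊕ β) where
  toFun := Sum.elim ![.inl (.inl 0), .inr (.inl ())]
    (Sum.elim ![.inl (.inl 1), .inl (.inl 2)] (Sum.map .inr .inr))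
  invFun := Sum.elim (Sum.elim ![.inl 0, .inr (.inl 0), .inr (.inl 1)] fun a => .inr (.inr (.inl a)))
    (Sum.elim (fun _ => .inl 1) fun b => .inr (.inr (.inr b)))
  left_inv := by
    rintro (i | i | i | i)
    · fin_cases i <;> rfl
    · fin_cases i <;> rfl
    · rfl
    · rfl
  right_inv := by
    rintro ((i | i) | (i | i))
    · fin_cases i <;> rfl
    · rfl
    · rfl
    · rfl

lemma exists_index_equiv {w : V} {a : Fin 3 → V} (hadj : ∀ k, G.Adj w (a k))
    (ha : Function.Injective a) (hnbr : ∀ x, G.Adj w x → ∃ k, x = a k) :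
    ∃ f : Fin 2 ⊕ (Fin 2 ⊕ ({e : G.edgeSet // w ∉ e.1} ⊕ {x // x ≠ a 0 ∧ x ≠ w})) ≃
        G.edgeSet ⊕ {x // x ≠ a 0},
      (∀ k, starPos f k = .inl (starEdge hadj k)) ∧
      f (.inl 1) = .inr ⟨w, (hadj 0).ne⟩ ∧
      (∀ e, f (.inr (.inr (.inl e))) = .inl e.1) ∧
      ∀ x, f (.inr (.inr (.inr x))) = .inr ⟨x.1, x.2.1⟩ := by
  obtain ⟨f, hf, hf'⟩ := exists_edge_equiv hadj ha hnbr
  let g₁ : Unit ⊕ {x // x ≠ a 0 ∧ x ≠ w} → {x // x ≠ a 0} :=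
    Sum.elim (fun _ => ⟨w, (hadj 0).ne⟩) fun x => ⟨x.1, x.2.1⟩
  have hg₁ : Function.Bijective g₁ := by
    constructor
    · rintro (i | ⟨x, hx⟩) (j | ⟨y, hy⟩) h
      · rfl
      · exact absurd (congrArg Subtype.val h).symm hy.2
      · exact absurd (congrArg Subtype.val h) hx.2
      · simpa [g₁] using h
    · rintro ⟨x, hx⟩
      by_cases hxw : x = w
      · subst hxw; exact ⟨.inl (), rfl⟩
      · exact ⟨.inr ⟨x, hx, hxw⟩, rfl⟩
  refine ⟨(starShuffle _ _).trans (Equiv.sumCongr f (Equiv.ofBijective _ hg₁)),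
    fun k => ?_, rfl, fun e => ?_, fun x => rfl⟩
  · fin_cases k <;> simp [starPos, starShuffle, hf]
  · simp [starShuffle, hf']

/-- The border vectors `-e_{a 1}` and `-e_{a 2}`. -/
def unitBorder {R ι : Type*} [CommRing R] [DecidableEq ι] (j : Fin 2 → ι) : Matrix (Fin 2) ι R :=
  of fun k i => if i = j k then -1 else 0

lemma unitBorder_mul {R ι : Type*} [CommRing R] [Fintype ι] [DecidableEq ι] (j : Fin 2 → ι)
    (A : Matrix ι ι R) (k l : Fin 2) :
    ((unitBorder j : Matrix (Fin 2) ι R) * A * (unitBorder j : Matrix (Fin 2) ι R)ᵀ) k l = A (j k) (j l) := by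
  simp [Matrix.mul_apply, unitBorder, ite_mul]

/-- The two neighbours of `w` which are different from the root `a 0`. -/
def starIndex {w : V} {a : Fin 3 → V} (hadj : ∀ k, G.Adj w (a k)) (ha : Function.Injective a)
    (k : Fin 2) : {x // x ≠ a 0 ∧ x ≠ w} :=
  ⟨a k.succ, fun h => Fin.succ_ne_zero k (ha h), (hadj _).ne'⟩

lemma deletedIncidence_ne_zero_iff (o : G.edgeSet → V × V)
    (ho : ∀ e, s((o e).1, (o e).2) = e.1) (r w : V) (e : {e : G.edgeSet // w ∉ e.1})
    (x : {x // x ≠ r ∧ x ≠ w}) : deletedIncidence o r w e x ≠ 0 ↔ x.1 ∈ e.1.1 := by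
  have hne : (o e.1).1 ≠ (o e.1).2 := by
    have : G.Adj (o e.1).1 (o e.1).2 := by rw [← SimpleGraph.mem_edgeSet, ho]; exact e.1.2
    exact this.ne
  rw [← ho, Sym2.mem_iff]
  by_cases h1 : (o e.1).1 = x.1
  · have h2 : (o e.1).2 ≠ x.1 := fun h => hne (h1.trans h.symm)
    simp [deletedIncidence, h1, h2]
  · by_cases h2 : (o e.1).2 = x.1
    · simp [deletedIncidence, h1, h2]
    · simp [deletedIncidence, h1, h2, Ne.symm h1, Ne.symm h2]

lemma deletedIncidence_mul_self (o : G.edgeSet → V × V) (r w : V)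
    (e : {e : G.edgeSet // w ∉ e.1}) (x : {x // x ≠ r ∧ x ≠ w})
    (h : deletedIncidence o r w e x ≠ 0) :
    deletedIncidence o r w e x * deletedIncidence o r w e x = 1 := by
  simp only [deletedIncidence, of_apply] at h ⊢
  split_ifs at h ⊢ <;> simp_all

variable [Fintype V] [Fintype G.edgeSet]

/-- All edges at `w` point away from it, so the three signs are 1. The column of `a 0` is absent, so
the first edge contributes nothing to the border, and the other two contribute minus the unit
vectors at `a 1` and `a 2`. -/
lemma det_graphMatrix_of_trivalent {F : Type*} [Field F] {w : V} {a : Fin 3 → V}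
    (hadj : ∀ k, G.Adj w (a k)) (ha : Function.Injective a)
    (hnbr : ∀ x, G.Adj w x → ∃ k, x = a k) (o : G.edgeSet → V × V)
    (ho : ∀ e, s((o e).1, (o e).2) = e.1) (how : ∀ e : G.edgeSet, w ∈ e.1 → (o e).1 = w)
    (y : G.edgeSet → F) :
    (graphMatrix (incidence o (a 0)) y).det =
      -(fromBlocks (corner 1 fun k => y (starEdge hadj k))
        (unitBorder fun k => .inr (starIndex hadj ha k))
        (unitBorder fun k => .inr (starIndex hadj ha k))ᵀ
        (graphMatrix (deletedIncidence o (a 0) w) fun e => y e.1)).det := by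
  obtain ⟨f, hpos, hw, hfe, hfx⟩ := exists_index_equiv hadj ha hnbr
  have ho1 : ∀ k, (o (starEdge hadj k)).1 = w := fun k => how _ (mem_starEdge hadj k)
  have ho2 : ∀ k, (o (starEdge hadj k)).2 = a k := fun k => by
    have := ho (starEdge hadj k)
    rw [ho1] at this
    exact Sym2.congr_right.1 this
  have hinj := starEdge_injective hadj ha
  rw [det_of_star (graphMatrix (incidence o (a 0)) y) (graphMatrix_isSymm _ _) f
    (fun k => y (starEdge hadj k)) 1 (by simp)]
  · rw [Pi.one_apply, Pi.one_apply, one_mul]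
    have hB : (starBorder 1 fun k i => graphMatrix (incidence o (a 0)) y (starPos f k)
        (f (.inr (.inr i)))) = unitBorder fun k => .inr (starIndex hadj ha k) := by
      ext k (e | x)
      · have h1 : ∀ l, starEdge hadj l ≠ e.1 := fun l h => e.2 (h ▸ mem_starEdge hadj l)
        simp [starBorder, hpos, hfe, graphMatrix, unitBorder, h1]
      · have h0 : a 0 ≠ x.1 := x.2.1.symm
        have hw : w ≠ x.1 := x.2.2.symm
        simp only [starBorder, hpos, hfx, graphMatrix, unitBorder, of_apply, fromBlocks_apply₁₂,
          map_apply, incidence, ho1, ho2, h0, hw, if_false, Sum.inr.injEq, starIndex,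
          Subtype.ext_iff]
        by_cases h : a k.succ = x.1
        · simp [h]
        · simp [h, Ne.symm h]
    rw [hB]
    congr 3
    ext (i | i) (j | j)
    · by_cases h : i = j
      · subst h; simp [hfe, graphMatrix]
      · have : i.1 ≠ j.1 := fun h' => h (Subtype.ext h')
        simp [hfe, graphMatrix, h, this]
    · simp [hfe, hfx, graphMatrix, incidence, deletedIncidence]
    · simp [hfe, hfx, graphMatrix, incidence, deletedIncidence]
    · simp [hfx, graphMatrix]
  · intro k l
    rw [hpos, hpos]
    by_cases h : k = l
    · subst h; simp [graphMatrix]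
    · simp [graphMatrix, h, hinj.ne h]
  · rw [hw]; simp [graphMatrix]
  · intro k
    have : a k ≠ w := (hadj k).ne'
    rw [hw, hpos]
    simp [graphMatrix, incidence, ho1, ho2, this]
  · rintro (e | x)
    · have h1 : w ≠ (o e.1).1 ∧ w ≠ (o e.1).2 := by
        have := e.2
        rw [← ho, Sym2.mem_iff] at this
        tauto
      rw [hw, hfe]
      simp [graphMatrix, incidence, h1.1.symm, h1.2.symm]
    · rw [hw, hfx]
      simp [graphMatrix]

lemma card_support_deletedIncidence [DecidableRel G.Adj] (o : G.edgeSet → V × V)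
    (ho : ∀ e, s((o e).1, (o e).2) = e.1) (r w : V) (x : {x // x ≠ r ∧ x ≠ w})
    (hx : G.Adj w x.1) :
    (Finset.univ.filter fun e => deletedIncidence o r w e x ≠ 0).card + 1 = G.degree x.1 := by
  have h1 : ((Finset.univ.filter fun e => deletedIncidence o r w e x ≠ 0).image
      fun e => e.1.1) = (G.incidenceFinset x.1).erase s(w, x.1) := by
    ext e
    simp only [Finset.mem_image, Finset.mem_filter, Finset.mem_univ, true_and,
      deletedIncidence_ne_zero_iff o ho, Finset.mem_erase, SimpleGraph.mem_incidenceFinset,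
      SimpleGraph.incidenceSet, Set.mem_sep_iff]
    constructor
    · rintro ⟨⟨⟨e, he⟩, hwe⟩, hxe, rfl⟩
      exact ⟨fun h => hwe (h ▸ Sym2.mem_mk_left _ _), he, hxe⟩
    · rintro ⟨hne, he, hxe⟩
      refine ⟨⟨⟨e, he⟩, fun hwe => hne ?_⟩, hxe, rfl⟩
      exact (Sym2.mem_and_mem_iff x.2.2.symm).1 ⟨hwe, hxe⟩
  have h2 : s(w, x.1) ∈ G.incidenceFinset x.1 := by
    rw [SimpleGraph.mem_incidenceFinset]
    exact ⟨hx, Sym2.mem_mk_right _ _⟩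
  rw [← Finset.card_image_of_injective (f := fun e : {e : G.edgeSet // w ∉ e.1} => e.1.1) _
    (Subtype.val_injective.comp Subtype.val_injective), h1, Finset.card_erase_add_one h2,
    SimpleGraph.card_incidenceFinset_eq_degree]

end Trivalent

end C2Invariant

/-! ### The `c₂` invariant at prime powers -/

namespace C2Invariant

open Matrix

section Counting

variable {V : Type u} {G : SimpleGraph V}

lemma exists_orientation (w : V) : ∃ o : G.edgeSet → V × V,
    (∀ e, s((o e).1, (o e).2) = e.1) ∧ ∀ e : G.edgeSet, w ∈ e.1 → (o e).1 = w := by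
  have h : ∀ e : G.edgeSet, ∃ t : V × V, s(t.1, t.2) = e.1 ∧ (w ∈ e.1 → t.1 = w) := by
    intro e
    by_cases he : w ∈ e.1
    · obtain ⟨x, hx⟩ := he
      exact ⟨(w, x), hx.symm, fun _ => rfl⟩
    · rcases e with ⟨⟨x, y⟩, he'⟩
      exact ⟨(x, y), rfl, fun h => absurd h he⟩
  choose o ho using h
  exact ⟨o, fun e => (ho e).1, fun e => (ho e).2⟩

lemma card_edges_avoiding [Fintype G.edgeSet] [DecidableEq V] {w : V} {a : Fin 3 → V}
    (hadj : ∀ k, G.Adj w (a k)) (ha : Function.Injective a)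
    (hnbr : ∀ x, G.Adj w x → ∃ k, x = a k) :
    Fintype.card G.edgeSet = Fintype.card {e : G.edgeSet // w ∉ e.1} + 3 := by
  obtain ⟨f, -⟩ := exists_edge_equiv hadj ha hnbr
  rw [← Fintype.card_congr f, Fintype.card_sum, Fintype.card_fin, add_comm]

variable [Fintype V]

lemma card_vertices_deleted [DecidableEq V] {r w : V} (h : r ≠ w) :
    Fintype.card {x // x ≠ r ∧ x ≠ w} + 2 = Fintype.card V := by
  rw [Fintype.card_subtype]
  have : (Finset.univ.filter fun x => x ≠ r ∧ x ≠ w) = ({r, w} : Finset V)ᶜ := by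
    ext x; simp
  rw [this, Finset.card_compl, Finset.card_pair h]
  have := Finset.card_le_univ ({r, w} : Finset V)
  rw [Finset.card_pair h] at this
  omega

lemma exists_pointCount_eq [DecidableEq V] [DecidableRel G.Adj] {F : Type*} [Field F] [Finite F]
    {w : V} {a : Fin 3 → V} (hadj : ∀ k, G.Adj w (a k)) (ha : Function.Injective a)
    (hnbr : ∀ x, G.Adj w x → ∃ k, x = a k) (hdeg : ∀ k, G.degree (a k) = 3 ∨ G.degree (a k) = 4)
    (hE : 4 ≤ Fintype.card G.edgeSet) (o : G.edgeSet → V × V)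
    (ho : ∀ e, s((o e).1, (o e).2) = e.1) (how : ∀ e : G.edgeSet, w ∈ e.1 → (o e).1 = w) :
    ∃ m, pointCount (kirchhoffPoly G) F = Nat.card F ^ 2 * m ∧
      m ≡ Nat.card {z : {e : G.edgeSet // w ∉ e.1} → F //
        (graphMatrix (deletedIncidence o (a 0) w) z).det = 0 ∧
        (graphMatrix (deletedIncidence o (a 0) w) z).adjugate
          (.inr (starIndex hadj ha 0)) (.inr (starIndex hadj ha 1)) = 0} [MOD Nat.card F] := by
  classical
  have := Fintype.ofFinite F
  obtain ⟨f, hf, hf'⟩ := exists_edge_equiv hadj ha hnbr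
  set B := deletedIncidence o (a 0) w with hB
  set j : Fin 2 → {e : G.edgeSet // w ∉ e.1} ⊕ {x // x ≠ a 0 ∧ x ≠ w} :=
    fun k => .inr (starIndex hadj ha k) with hj
  set U : Matrix (Fin 2) _ F := unitBorder j with hU
  set W : ({e : G.edgeSet // w ∉ e.1} → F) → Matrix (Fin 2) (Fin 2) F :=
    fun z => U * (graphMatrix B z).adjugate * Uᵀ with hWdef
  have hWapply : ∀ z k l, W z k l = (graphMatrix B z).adjugate (j k) (j l) := fun z k l =>
    unitBorder_mul j _ k l
  have hσ : (swapSign {x // x ≠ a 0} : F) ≠ 0 := by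
    have := congrArg (Int.cast : ℤ → F) (swapSign_mul_self (ι := {x // x ≠ a 0}))
    rw [Int.cast_mul, Int.cast_one] at this
    exact left_ne_zero_of_mul_eq_one this
  have hcount : pointCount (kirchhoffPoly G) F =
      ∑ z : {e : G.edgeSet // w ∉ e.1} → F, Nat.card {x : Fin 3 → F //
        borderPoly (corner 1 x) (W z) (graphMatrix B z).det
          (fromBlocks 0 U Uᵀ (graphMatrix B z)).det = 0} := by
    rw [pointCount, card_eq_sum_fibers f]
    refine Finset.sum_congr rfl fun z _ => ?_
    refine Nat.card_congr (Equiv.subtypeEquivRight fun x => ?_)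
    set y : G.edgeSet → F := Sum.elim x z ∘ f.symm with hy
    have hyk : ∀ k, y (starEdge hadj k) = x k := fun k => by
      rw [← hf]; simp [y]
    have hye : ∀ e : {e : G.edgeSet // w ∉ e.1}, y e.1 = z e := fun e => by
      rw [← hf']; simp [y]
    have h1 := det_graphMatrix_incidence o ho (a 0) y
    rw [det_graphMatrix_of_trivalent hadj ha hnbr o ho how] at h1
    simp only [hyk, hye] at h1
    rw [← mul_eq_zero_iff_left hσ, ← h1, neg_eq_zero, det_fromBlocks_eq_borderPoly]
  have hH := card_edges_avoiding hadj ha hnbr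
  -- For the minor at one of the neighbours `a 1`, `a 2`, the other one serves as the vertex of
  -- degree 2 or 3: it has lost exactly its edge to `w`.
  have hA : ∀ k l : Fin 2, k ≠ l → Nat.card F ∣
      Nat.card {z // (graphMatrix B z).det = 0 ∧ W z k k = 0} := by
    intro k l hkl
    simp only [hWapply]
    refine card_dvd_card_common_zeros_graphMatrix B (starIndex hadj ha l) (starIndex hadj ha k)
      ?_ (fun e he => deletedIncidence_mul_self o (a 0) w e _ he) ?_
    · intro h
      exact hkl (Fin.succ_injective _ (ha (congrArg Subtype.val h)))
    · have h1 := card_support_deletedIncidence o ho (a 0) w (starIndex hadj ha l) (hadj _)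
      have h2 := hdeg l.succ
      have h3 : G.degree (starIndex hadj ha l).1 = G.degree (a l.succ) := rfl
      rw [h3, ← hB] at h1
      omega
  obtain ⟨m, hm, hm'⟩ := sum_card_corner_zeros (1 : F) (one_mul 1)
    (fun z => (graphMatrix B z).det) (fun z => (fromBlocks 0 U Uᵀ (graphMatrix B z)).det) W
    (fun z => by
      rw [hWapply, hWapply]
      have := (graphMatrix_isSymm B z).eq
      rw [← transpose_apply (graphMatrix B z).adjugate, adjugate_transpose, this])
    (fun z => by
      have := det_fromBlocks_mul_det 0 U Uᵀ (graphMatrix B z)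
      rw [mul_comm, this]
      simp [det_fin_two, hWdef])
    (by
      rw [Nat.card_fun]
      refine dvd_pow_self _ ?_
      rw [Nat.card_eq_fintype_card]
      omega)
    (hA 0 1 (by simp)) (hA 1 0 (by simp))
  refine ⟨m, hcount.trans hm, ?_⟩
  simpa only [hWapply] using hm'

/-- All values `c₂` at powers of `p` are governed modulo `p` by one residue class. -/
lemma exists_forall_c2_eq [DecidableEq V] [DecidableRel G.Adj] (p : ℕ) [Fact p.Prime]
    {w : V} {a : Fin 3 → V} (hadj : ∀ k, G.Adj w (a k)) (ha : Function.Injective a)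
    (hnbr : ∀ x, G.Adj w x → ∃ k, x = a k) (hdeg : ∀ k, G.degree (a k) = 3 ∨ G.degree (a k) = 4)
    (hV : 4 ≤ Fintype.card V) (hE : Fintype.card G.edgeSet + 2 = 2 * Fintype.card V) :
    ∃ C : ZMod p, ∀ (s : ℕ) (hs : s ≠ 0), (p ^ s) ^ 2 ∣ kirchhoffCount G p s ∧
      ZMod.castHom (dvd_pow_self p hs) (ZMod p) (c2 G p s) = -C ^ s := by
  classical
  obtain ⟨o, ho, how⟩ := exists_orientation (G := G) w
  have hH := card_edges_avoiding hadj ha hnbr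
  have hV' := card_vertices_deleted (hadj 0).ne'
  set M := graphMatrix (deletedIncidence o (a 0) w)
    (MvPolynomial.X : _ → MvPolynomial {e : G.edgeSet // w ∉ e.1} (ZMod p)) with hM
  set D := M.adjugate (.inr (starIndex hadj ha 0)) (.inr (starIndex hadj ha 1)) with hD
  refine ⟨MvPolynomial.coeff (constExp _ (p - 1)) ((M.det * D) ^ (p - 1)), fun s hs => ?_⟩
  have hcardF : Nat.card (GaloisField p s) = p ^ s := GaloisField.card p s hs
  obtain ⟨m, hm, hm'⟩ := exists_pointCount_eq (F := GaloisField p s) hadj ha hnbr hdeg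
    (by omega) o ho how
  rw [hcardF] at hm hm'
  have hcount : kirchhoffCount G p s = (p ^ s) ^ 2 * m := hm
  refine ⟨hcount ▸ dvd_mul_right _ _, ?_⟩
  have hpos : 0 < (p ^ s) ^ 2 := by
    have := (Fact.out : p.Prime).pos
    positivity
  rw [c2, map_natCast, hcount, Nat.mul_div_cancel_left _ hpos,
    (ZMod.natCast_eq_natCast_iff _ _ _).2 (hm'.of_dvd (dvd_pow_self p hs))]
  -- `G - w` has `2 * |V| - 5` edges, and `|V| - 2` vertex columns remain, so the two degree bounds
  -- add up exactly to the number of variables.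
  have hd1 : M.det.totalDegree ≤ Fintype.card V - 3 :=
    totalDegree_det_graphMatrix_le _ _ (by omega)
  have hd2 : D.totalDegree ≤ Fintype.card V - 2 :=
    totalDegree_adjugate_graphMatrix_le _ _ _ _ (by omega)
  have h := natCast_card_common_zeros p s hcardF M.det D (by omega) (by omega) (by omega)
  simp only [hD, hM, aeval_det_graphMatrix, aeval_adjugate_graphMatrix] at h
  -- The number of variables `2 * |V| - 5` is odd.
  rw [h, hD, hM, Odd.neg_one_pow, neg_one_mul]
  rw [Nat.odd_iff]
  omega

end Counting

/-! ### Primitive divergent graphs -/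

section Primitive

variable {V : Type u} [Fintype V]

lemma degree_eq_sum_ite (G : SimpleGraph V) [DecidableRel G.Adj] (x : V) :
    G.degree x = ∑ y, if G.Adj x y then 1 else 0 := by
  rw [← SimpleGraph.card_neighborFinset_eq_degree, SimpleGraph.neighborFinset_eq_filter,
    Finset.card_filter]

lemma degree_some (K : SimpleGraph (Option V)) [DecidableRel K.Adj]
    [DecidableRel (K.comap Option.some).Adj] (x : V) :
    K.degree (some x) = (if K.Adj none (some x) then 1 else 0) +
      (K.comap Option.some).degree x := by
  rw [degree_eq_sum_ite, degree_eq_sum_ite, Fintype.sum_option]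
  simp only [SimpleGraph.comap_adj, K.adj_comm (some x) none]

lemma degree_none (K : SimpleGraph (Option V)) [DecidableRel K.Adj] :
    K.degree none = ∑ x, if K.Adj none (some x) then 1 else 0 := by
  rw [degree_eq_sum_ite, Fintype.sum_option]
  simp

lemma PrimitiveDivergent.exists_forall_c2_eq {G : SimpleGraph V} (hG : PrimitiveDivergent G)
    (p : ℕ) [Fact p.Prime] :
    ∃ C : ZMod p, ∀ (s : ℕ) (hs : s ≠ 0), (p ^ s) ^ 2 ∣ kirchhoffCount G p s ∧
      ZMod.castHom (dvd_pow_self p hs) (ZMod p) (c2 G p s) = -C ^ s := by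
  classical
  obtain ⟨K, -, hreg, -, rfl⟩ := hG
  have hK : ∀ x, K.degree x = 4 := fun x => by
    rw [← hreg.degree_eq x]
  have hdeg : ∀ x, (K.comap Option.some).degree x +
      (if K.Adj none (some x) then 1 else 0) = 4 := fun x => by
    rw [add_comm, ← degree_some, hK]
  have hnone : ∑ x : V, (if K.Adj none (some x) then 1 else 0) = 4 := by
    rw [← degree_none, hK]
  have hV : 4 ≤ Fintype.card V := by
    have := K.degree_lt_card_verts none
    rw [hK, Fintype.card_option] at this
    omega
  -- The degrees in `G` sum to `4 * |V| - 4`, since the deleted vertex had four edges.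
  have hE : Fintype.card (K.comap Option.some).edgeSet + 2 = 2 * Fintype.card V := by
    have h1 := (K.comap Option.some).sum_degrees_eq_twice_card_edges
    have h2 : ∑ x : V, ((K.comap Option.some).degree x +
        (if K.Adj none (some x) then 1 else 0)) = ∑ _x : V, 4 :=
      Finset.sum_congr rfl fun x _ => hdeg x
    rw [Finset.sum_add_distrib, hnone, h1, Finset.sum_const, Finset.card_univ, smul_eq_mul,
      SimpleGraph.edgeFinset_card] at h2
    omega
  obtain ⟨w, hw⟩ : ∃ w, K.Adj none (some w) := by
    by_contra! h
    simp [h] at hnone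
  have hdw : (K.comap Option.some).degree w = 3 := by
    have := hdeg w
    rw [if_pos hw] at this
    omega
  let τ : Fin 3 ≃ (K.comap Option.some).neighborFinset w :=
    (finCongr (by rw [SimpleGraph.card_neighborFinset_eq_degree, hdw])).trans
      (Finset.equivFin _).symm
  refine C2Invariant.exists_forall_c2_eq p (w := w) (a := fun k => (τ k).1)
    (fun k => (SimpleGraph.mem_neighborFinset _ _ _).1 (τ k).2)
    (Subtype.val_injective.comp τ.injective) (fun x hx => ?_) (fun k => ?_) hV hE
  · refine ⟨τ.symm ⟨x, (SimpleGraph.mem_neighborFinset _ _ _).2 hx⟩, ?_⟩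
    simp
  · have := hdeg (τ k).1
    split_ifs at this <;> omega

end Primitive

end C2Invariant

theorem theorem1 {V : Type u} [Fintype V] (G : SimpleGraph V)
    (hG : C2Invariant.PrimitiveDivergent G)
    (p : ℕ) [Fact p.Prime] (s : ℕ) (hs : s ≠ 0) :
    (p ^ s) ^ 2 ∣ C2Invariant.kirchhoffCount G p s ∧
    ZMod.castHom (dvd_pow_self p hs) (ZMod p) (C2Invariant.c2 G p s) =
      (-1) ^ (s + 1) *
        (ZMod.castHom (dvd_pow_self p one_ne_zero) (ZMod p) (C2Invariant.c2 G p 1)) ^ s ∧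
    ∀ (W : Type v) [Fintype W] (G' : SimpleGraph W), C2Invariant.PrimitiveDivergent G' →
      C2Invariant.c2 G p 1 = C2Invariant.c2 G' p 1 →
        ZMod.castHom (dvd_pow_self p hs) (ZMod p) (C2Invariant.c2 G p s) =
          ZMod.castHom (dvd_pow_self p hs) (ZMod p) (C2Invariant.c2 G' p s) := by
  -- At `q = p` the invariant is `-C`, so the sign in the theorem comes from rewriting `-C ^ s` in
  -- terms of `(-C) ^ s`.
  have hpow : ∀ C : ZMod p, -C ^ s = (-1) ^ (s + 1) * (-C ^ 1) ^ s := by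
    intro C
    rw [pow_one, neg_pow C s, ← mul_assoc, ← pow_add]
    have : Odd (s + 1 + s) := ⟨s, by ring⟩
    rw [this.neg_one_pow, neg_one_mul]
  obtain ⟨C, hC⟩ := hG.exists_forall_c2_eq p
  refine ⟨(hC s hs).1, ?_, fun W _ G' hG' h => ?_⟩
  · rw [(hC s hs).2, (hC 1 one_ne_zero).2, hpow]
  · obtain ⟨C', hC'⟩ := hG'.exists_forall_c2_eq p
    rw [(hC s hs).2, (hC' s hs).2, hpow C, hpow C', ← (hC 1 one_ne_zero).2,
      ← (hC' 1 one_ne_zero).2, h]
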